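/- Let $X$ be a nonempty compact Hausdorff zero-dimensional space (the clopen sets form a basis) which is h-homogeneous, i.e. every nonempty clopen subset of $X$ is homeomorphic to $X$, and let $G=\mathrm{Homeo}(X)$. Let $\Phi(X)$ be the space of maximal chains (with respect to inclusion) of nonempty closed subsets of $X$, regarded as a subspace of $\mathrm{Exp}(\mathrm{Exp}(X))$, where $\mathrm{Exp}(K)$ is the space of nonempty closed subsets of a compact Hausdorff space $K$ with the Vietoris topology; $G$ acts by $gc=\{g(A):A\in c\}$. For $k\in\mathbb N$ let $D_k$ be the set of ordered partitions $\beta=(B_1,\dots,B_k)$ of $X$ into $k$ nonempty clopen sets. The group $G$ acts on $D_k$ by $g\beta=(g(B_1),\dots,g(B_k))$, and for $\sigma\in S_k$ put $\sigma\beta=(B_{\sigma(1)},\dots,B_{\sigma(k)})$. Let $\Omega_k=\{1,-1\}^{D_k}$ with the product topology and the $G$-action $(g\omega)(\beta)=\omega(g^{-1}\beta)$. For $c\in\Phi(X)$ and a nonempty clopen $D\subseteq X$ let $D_c=\bigcap\{A\in c: A\cap D\neq\emptyset\}$. For $\beta\in D_k$ let $\theta_\beta(c)\in S_k$ be the unique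 permutation $\theta$ such that $i\le j\Leftrightarrow (B_{\theta(i)})_c\subseteq (B_{\theta(j)})_c$ for all $i,j$, i.e. such that $\theta\beta$ lists the pieces of $\beta$ in the linear order induced by $c$. For a table $T\in\{1,-1\}^{S_k}$ define $\varphi_T:\Phi(X)\to\Omega_k$ by $\varphi_T(c)(\beta)=T(\theta_\beta(c))$. **Theorem.** For every $k$, every minimal subsystem $\Sigma$ of $(G,\Omega_k)$ (a nonempty closed $G$-invariant subset of $\Omega_k$ whose only closed $G$-invariant subsets are $\emptyset$ and $\Sigma$) is a factor of $(G,\Phi(X))$. More precisely, there is a table $T\in\{1,-1\}^{S_k}$ such that $\varphi_T$ is continuous and $G$-equivariant and $\varphi_T(\Phi(X))=\Sigma$. -/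

import Mathlib

open Set TopologicalSpace

/-- A compact Hausdorff space `X` is zero-dimensional and h-homogeneous: the clopen sets form a
basis of the topology, and every nonempty clopen subset of `X` is homeomorphic to `X`. -/
structure IsHHomogeneous (X : Type*) [TopologicalSpace X] : Prop where
  zeroDimensional : IsTopologicalBasis {U : Set X | IsClopen U}
  homeomorphic : ∀ U : Set X, IsClopen U → U.Nonempty → Nonempty (U ≃ₜ X)

/-! ### Minimal subsystems and factors -/

/-- `S` is a minimal subsystem of the `G`-space `Z`: a nonempty closed invariant subset whose only
closed invariant subsets are `∅` and `S`. -/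
structure IsMinimalSubsystem (G : Type*) {Z : Type*} [Group G] [TopologicalSpace Z] [MulAction G Z]
    (S : Set Z) : Prop where
  nonempty : S.Nonempty
  isClosed : IsClosed S
  smul_mem : ∀ (g : G), ∀ z ∈ S, g • z ∈ S
  eq_empty_or_eq : ∀ F : Set Z, F ⊆ S → IsClosed F → (∀ (g : G), ∀ z ∈ F, g • z ∈ F) →
    F = ∅ ∨ F = S

/-- `f` is a factor map from the `G`-space `Y` onto the subsystem `S` of the `G`-space `Z`:
a continuous `G`-equivariant map with image `S`. -/
structure IsFactorMapOnto (G : Type*) {Y Z : Type*} [Group G] [TopologicalSpace Y]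
    [TopologicalSpace Z] [MulAction G Y] [MulAction G Z] (f : Y → Z) (S : Set Z) : Prop where
  continuous : Continuous f
  map_smul : ∀ (g : G) (y : Y), f (g • y) = g • f y
  range_eq : Set.range f = S

/-! ### The space of maximal chains -/

/-- The order isomorphism of the poset of nonempty compact subsets induced by a homeomorphism. -/
def expIso {X : Type*} [TopologicalSpace X] (g : X ≃ₜ X) :
    NonemptyCompacts X ≃o NonemptyCompacts X where
  toFun := NonemptyCompacts.map g g.continuous
  invFun := NonemptyCompacts.map g.symm g.symm.continuous
  left_inv K := by
    ext x
    simp [Set.image_image]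
  right_inv K := by
    ext x
    simp [Set.image_image]
  map_rel_iff' := by
    intro K L
    exact Set.image_subset_image_iff (s := (K : Set X)) (t := (L : Set X)) g.injective

theorem continuous_expIso {X : Type*} [TopologicalSpace X] (g : X ≃ₜ X) :
    Continuous (expIso g) := by
  change Continuous (NonemptyCompacts.map g g.continuous)
  fun_prop

/-- The space `Φ(X)` of maximal chains of nonempty closed subsets of the compact Hausdorff space
`X`. `NonemptyCompacts X` is the space of nonempty closed subsets with the Vietoris topology; maximal
chains are closed in it, and `Φ(X)` is a subspace of `NonemptyCompacts (NonemptyCompacts X)`. -/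
def MaximalChain (X : Type*) [TopologicalSpace X] : Type _ :=
  {c : NonemptyCompacts (NonemptyCompacts X) //
    IsMaxChain (· ≤ ·) (c : Set (NonemptyCompacts X))}

namespace MaximalChain

instance {X : Type*} [TopologicalSpace X] : TopologicalSpace (MaximalChain X) :=
  inferInstanceAs (TopologicalSpace {c : NonemptyCompacts (NonemptyCompacts X) //
    IsMaxChain (· ≤ ·) (c : Set (NonemptyCompacts X))})

/-- The set of members of a maximal chain. -/
def members {X : Type*} [TopologicalSpace X] (c : MaximalChain X) : Set (NonemptyCompacts X) :=
  (c.1 : Set (NonemptyCompacts X))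

theorem ext_members {X : Type*} [TopologicalSpace X] {c d : MaximalChain X}
    (h : c.members = d.members) : c = d :=
  Subtype.ext (NonemptyCompacts.ext h)

/-- `g c = {g(A) : A ∈ c}`. -/
instance {X : Type*} [TopologicalSpace X] : SMul (X ≃ₜ X) (MaximalChain X) where
  smul g c := ⟨NonemptyCompacts.map (expIso g) (continuous_expIso g) c.1,
    IsMaxChain.image (expIso g) c.2⟩

theorem members_smul {X : Type*} [TopologicalSpace X] (g : X ≃ₜ X) (c : MaximalChain X) :
    (g • c).members = expIso g '' c.members := rfl

instance {X : Type*} [TopologicalSpace X] : MulAction (X ≃ₜ X) (MaximalChain X) where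
  one_smul c := by
    apply ext_members
    have h : (expIso (1 : X ≃ₜ X) : NonemptyCompacts X → NonemptyCompacts X) = id := by
      funext K
      exact NonemptyCompacts.ext (Set.image_id _)
    rw [members_smul, h, Set.image_id]
  mul_smul g h c := by
    apply ext_members
    rw [members_smul, members_smul, members_smul, Set.image_image]
    refine Set.image_congr fun K _ => NonemptyCompacts.ext ?_
    exact Set.image_comp g h (K : Set X)

/-- The smallest member of the chain `c` that meets `D`, as the intersection of all members of `c`
that meet `D`. -/
def firstHit {X : Type*} [TopologicalSpace X] (c : MaximalChain X) (D : Set X) : Set X :=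
  ⋂ A ∈ {A ∈ c.members | ((A : Set X) ∩ D).Nonempty}, (A : Set X)

/-- The order induced by the chain `c` on the pieces of a partition: `A` precedes or equals `B` if
the first member of `c` meeting `A` is contained in the first member of `c` meeting `B`. -/
def InducedLE {X : Type*} [TopologicalSpace X] (c : MaximalChain X) (A B : Set X) : Prop :=
  c.firstHit A ⊆ c.firstHit B

end MaximalChain

/-! ### Ordered clopen partitions -/

/-- The set `D_k` of ordered partitions of `X` into `k` nonempty clopen sets. -/
@[ext]
structure OrderedPartition (X : Type*) [TopologicalSpace X] (k : ℕ) where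
  part : Fin k → Set X
  isClopen : ∀ i, IsClopen (part i)
  nonempty : ∀ i, (part i).Nonempty
  disjoint : ∀ i j, i ≠ j → Disjoint (part i) (part j)
  iUnion_eq : ⋃ i, part i = Set.univ

namespace OrderedPartition

/-- `g (A₁, …, A_k) = (g(A₁), …, g(A_k))`. -/
instance {X : Type*} [TopologicalSpace X] {k : ℕ} : SMul (X ≃ₜ X) (OrderedPartition X k) where
  smul g β :=
    { part := fun i => g '' β.part i
      isClopen := fun i => ⟨g.isClosedMap _ (β.isClopen i).1, g.isOpenMap _ (β.isClopen i).2⟩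
      nonempty := fun i => (β.nonempty i).image g
      disjoint := fun i j h => (Set.disjoint_image_iff g.injective).2 (β.disjoint i j h)
      iUnion_eq := by
        rw [← Set.image_iUnion, β.iUnion_eq, Set.image_univ, g.surjective.range_eq] }

instance {X : Type*} [TopologicalSpace X] {k : ℕ} :
    MulAction (X ≃ₜ X) (OrderedPartition X k) where
  one_smul β := by
    ext1
    funext i
    exact Set.image_id _
  mul_smul g h β := by
    ext1
    funext i
    exact Set.image_comp g h (β.part i)

/-- `σ (B₁, …, B_k) = (B_{σ(1)}, …, B_{σ(k)})`. -/
def permute {X : Type*} [TopologicalSpace X] {k : ℕ} (σ : Equiv.Perm (Fin k))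
    (β : OrderedPartition X k) : OrderedPartition X k where
  part := fun i => β.part (σ i)
  isClopen := fun i => β.isClopen (σ i)
  nonempty := fun i => β.nonempty (σ i)
  disjoint := fun i j h => β.disjoint (σ i) (σ j) (σ.injective.ne h)
  iUnion_eq := by
    rw [← β.iUnion_eq]
    exact σ.surjective.iUnion_comp β.part

/-- The pieces of `β` are listed in the order induced by the chain `c`. -/
def IsOrderedBy {X : Type*} [TopologicalSpace X] {k : ℕ} (β : OrderedPartition X k)
    (c : MaximalChain X) : Prop :=
  ∀ i j, i ≤ j ↔ c.InducedLE (β.part i) (β.part j)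

end OrderedPartition

/-! ### The induced order is linear -/

section Induced

open MaximalChain

theorem MaximalChain.inducedLE_total {X : Type*} [TopologicalSpace X] (c : MaximalChain X)
    (D E : Set X) : c.InducedLE D E ∨ c.InducedLE E D := by
  by_contra! h
  simp only [InducedLE, firstHit, Set.not_subset, Set.mem_iInter] at h
  obtain ⟨⟨x, hx, hx'⟩, ⟨y, hy, hy'⟩⟩ := h
  push Not at hx' hy'
  obtain ⟨A, hA, hxA⟩ := hx'
  obtain ⟨B, hB, hyB⟩ := hy'
  rcases c.2.1.total hA.1 hB.1 with h | h
  · exact hyB (hy B ⟨hB.1, hA.2.mono (Set.inter_subset_inter_left _ h)⟩)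
  · exact hxA (hx A ⟨hA.1, hB.2.mono (Set.inter_subset_inter_left _ h)⟩)

theorem MaximalChain.firstHit_inter_nonempty {X : Type*} [TopologicalSpace X] [CompactSpace X]
    [T2Space X] (c : MaximalChain X) {D : Set X} (hD : IsClosed D) (hne : D.Nonempty) :
    (c.firstHit D ∩ D).Nonempty := by
  have : Nonempty X := ⟨hne.some⟩
  have htop : (⊤ : NonemptyCompacts X) ∈ c.members := c.2.top_mem
  let S : Set (Set X) := (fun A : NonemptyCompacts X => (A : Set X) ∩ D) ''
    {A ∈ c.members | ((A : Set X) ∩ D).Nonempty}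
  have hS : (⋂₀ S).Nonempty := by
    have hSne : Nonempty S := ⟨_, ⊤, ⟨htop, by simpa using! hne⟩, rfl⟩
    apply IsCompact.nonempty_sInter_of_directed_nonempty_isCompact_isClosed
    · rintro _ ⟨A, hA, rfl⟩ _ ⟨B, hB, rfl⟩
      rcases c.2.1.total hA.1 hB.1 with h | h
      · exact ⟨_, ⟨A, hA, rfl⟩, subset_rfl, Set.inter_subset_inter_left _ h⟩
      · exact ⟨_, ⟨B, hB, rfl⟩, Set.inter_subset_inter_left _ h, subset_rfl⟩
    · rintro _ ⟨A, hA, rfl⟩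
      exact hA.2
    · rintro _ ⟨A, hA, rfl⟩
      exact A.isCompact.inter_right hD
    · rintro _ ⟨A, hA, rfl⟩
      exact A.isCompact.isClosed.inter hD
  obtain ⟨x, hx⟩ := hS
  refine ⟨x, ?_, ?_⟩
  · simp only [firstHit, Set.mem_iInter]
    exact fun A hA => (hx _ ⟨A, hA, rfl⟩).1
  · exact (hx _ ⟨⊤, ⟨htop, by simpa using! hne⟩, rfl⟩).2

theorem MaximalChain.firstHit_ne {X : Type*} [TopologicalSpace X] [CompactSpace X] [T2Space X]
    (c : MaximalChain X) {D E : Set X} (hD : IsClopen D) (hE : IsClopen E) (hDne : D.Nonempty)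
    (hEne : E.Nonempty) (hDE : Disjoint D E) : c.firstHit D ≠ c.firstHit E := by
  intro heq
  obtain ⟨x, hxF, hxD⟩ := c.firstHit_inter_nonempty hD.1 hDne
  obtain ⟨y, hyF, hyE⟩ := c.firstHit_inter_nonempty hE.1 hEne
  have hFc : IsClosed (c.firstHit D) :=
    isClosed_biInter fun A _ => A.isCompact.isClosed
  have hxE : x ∉ E := fun h => Set.disjoint_left.1 hDE hxD h
  let M : NonemptyCompacts X :=
    ⟨⟨c.firstHit D \ E, (hFc.inter hE.2.isClosed_compl).isCompact⟩, ⟨x, hxF, hxE⟩⟩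
  have hM : M ∈ c.members := by
    have hchain : IsChain (· ≤ ·) (insert M c.members) := by
      refine c.2.1.insert fun A hA _ => ?_
      by_cases hAE : ((A : Set X) ∩ E).Nonempty
      · left
        intro z hz
        have hz' : z ∈ c.firstHit E := heq ▸ hz.1
        exact Set.mem_iInter₂.1 hz' A ⟨hA, hAE⟩
      · right
        intro z hz
        refine ⟨?_, fun hzE => hAE ⟨z, hz, hzE⟩⟩
        rw [heq]
        refine Set.mem_iInter₂.2 fun B hB => ?_
        rcases c.2.1.total hA hB.1 with h | h
        · exact h hz
        · exact absurd (hB.2.mono (Set.inter_subset_inter_left _ h)) hAE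
    have h : c.members = insert M c.members := c.2.2 hchain (Set.subset_insert _ _)
    rw [h]
    exact Set.mem_insert M _
  have hy' : y ∈ c.firstHit D := heq ▸ hyF
  exact (Set.mem_iInter₂.1 hy' M ⟨hM, ⟨x, ⟨hxF, hxE⟩, hxD⟩⟩).2 hyE

open Classical in
/-- There is exactly one way to list the pieces of a clopen partition in the order induced by a
maximal chain. -/
theorem OrderedPartition.existsUnique_permute_isOrderedBy {X : Type*} [TopologicalSpace X]
    [CompactSpace X] [T2Space X] {k : ℕ} (β : OrderedPartition X k) (c : MaximalChain X) :
    ∃! σ : Equiv.Perm (Fin k), (β.permute σ).IsOrderedBy c := by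
  let f : Fin k → Set X := fun i => c.firstHit (β.part i)
  have hf : Function.Injective f := by
    intro i j h
    by_contra hij
    exact c.firstHit_ne (β.isClopen i) (β.isClopen j) (β.nonempty i) (β.nonempty j)
      (β.disjoint i j hij) h
  have key : ∀ σ : Equiv.Perm (Fin k), (β.permute σ).IsOrderedBy c ↔ StrictMono (f ∘ σ) := by
    intro σ
    constructor
    · intro h i j hij
      refine lt_of_le_of_ne ((h i j).1 hij.le) fun he => hij.ne (σ.injective (hf he))
    · intro h i j
      constructor
      · exact fun hij => h.monotone hij
      · intro hij
        by_contra hji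
        exact absurd hij (not_le_of_gt (h (lt_of_not_ge hji)))
  let _ : LinearOrder (Set.range f) :=
    { (inferInstance : PartialOrder (Set.range f)) with
      le_total := by
        rintro ⟨_, i, rfl⟩ ⟨_, j, rfl⟩
        exact c.inducedLE_total (β.part i) (β.part j)
      toDecidableLE := Classical.decRel _ }
  let f' : Fin k → Set.range f := fun i => ⟨f i, i, rfl⟩
  refine ⟨Tuple.sort f', (key _).2 ?_, ?_⟩
  · have hm : Monotone (f' ∘ Tuple.sort f') := Tuple.monotone_sort f'
    have hm' : Monotone (f ∘ Tuple.sort f') := fun i j hij => hm hij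
    exact hm'.strictMono_of_injective (hf.comp (Tuple.sort f').injective)
  · intro τ hτ
    have h1 : StrictMono (f' ∘ τ) := fun i j hij => (key τ).1 hτ hij
    have h2 := Tuple.eq_sort_iff.2 ⟨h1.monotone, fun i j hij he =>
      absurd (h1.injective he) hij.ne⟩
    exact h2

end Induced

/-! ### The symbolic space and the maps given by tables -/

/-- The `β`-ratio `θ_β(c)` of the chain `c`: the unique permutation `θ` such that `θ β` lists the
pieces of `β` in the order induced by `c`. -/
noncomputable def MaximalChain.ratio {X : Type*} [TopologicalSpace X] [CompactSpace X] [T2Space X]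
    {k : ℕ} (c : MaximalChain X) (β : OrderedPartition X k) : Equiv.Perm (Fin k) :=
  (β.existsUnique_permute_isOrderedBy c).choose

theorem MaximalChain.isOrderedBy_ratio {X : Type*} [TopologicalSpace X] [CompactSpace X]
    [T2Space X] {k : ℕ} (c : MaximalChain X) (β : OrderedPartition X k) :
    (β.permute (c.ratio β)).IsOrderedBy c :=
  (β.existsUnique_permute_isOrderedBy c).choose_spec.1

/-- The symbolic space `Ω_k = {1,-1}^{D_k}`. -/
def SymbolicSpace (X : Type*) [TopologicalSpace X] (k : ℕ) : Type _ :=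
  OrderedPartition X k → ℤˣ

namespace SymbolicSpace

/-- The product topology, with `{1,-1}` discrete. -/
instance {X : Type*} [TopologicalSpace X] {k : ℕ} : TopologicalSpace (SymbolicSpace X k) :=
  inferInstanceAs (TopologicalSpace (OrderedPartition X k → ℤˣ))

/-- `(g ω)(β) = ω(g⁻¹ β)`. -/
instance {X : Type*} [TopologicalSpace X] {k : ℕ} : MulAction (X ≃ₜ X) (SymbolicSpace X k) where
  smul g ω := fun β => ω (g⁻¹ • β)
  one_smul ω := by
    funext β
    change ω ((1 : X ≃ₜ X)⁻¹ • β) = ω β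
    rw [inv_one, one_smul]
  mul_smul g h ω := by
    funext β
    change ω ((g * h)⁻¹ • β) = ω (h⁻¹ • g⁻¹ • β)
    rw [mul_inv_rev, mul_smul]

end SymbolicSpace

/-- The map `φ_T : Φ(X) → Ω_k`, `φ_T(c)(β) = T(θ_β(c))`, given by a table `T ∈ {1,-1}^{S_k}`. -/
noncomputable def tableMap {X : Type*} [TopologicalSpace X] [CompactSpace X] [T2Space X] {k : ℕ}
    (T : Equiv.Perm (Fin k) → ℤˣ) : MaximalChain X → SymbolicSpace X k :=
  fun c β => T (c.ratio β)

/-! Fix a point `ω` of the minimal system. The aim is a table `T` such that every `tableMap T c` is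
a limit of translates of `ω`. Then the image of `tableMap T` lies in the system. The image is
nonempty, invariant and compact, because the space of maximal chains is compact and nonempty
(`MaximalChain.compactSpace`, `MaximalChain.nonempty`) and the map is continuous and equivariant.
Minimality makes it the whole system.

The table comes from the dual Ramsey theorem of Graham and Rothschild. Let `q` be a clopen partition
into pieces numbered from 0. Its coarsenings into `k` pieces, listed by their least indices, are the
rigid surjections, and any other listing differs by a permutation `σ`. Colouring a rigid surjection
by the table of values of `ω` on the relistings of its coarsening, one finds for each `m` a
partition into `m` pieces on whose coarsenings a single table governs `ω` (`exists_tableOn`). There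
are finitely many tables, so one of them works for all `m` (`exists_forall_tableOn`).

Given a chain `c` and finitely many partitions, take a common refinement listed in the order of `c`.
Each given partition, listed in the order of `c`, is then a rigid coarsening of it
(`exists_rigidSurj_of_isOrderedBy`). By h-homogeneity some homeomorphism carries the partition
governed by `T` to this refinement. The corresponding translate of `ω` agrees with `tableMap T c` at
the given partitions (`exists_smul_eq_tableMap`).

Graham-Rothschild is proved by descending induction on the number `a` of fixed initial values. For
`a = k` it is the multidimensional Hales-Jewett theorem. To pass from `a + 1` to `a`, look at the
first occurrence of `a`: the case `a + 1` removes the dependence on what follows it, Hales-Jewett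
over `a` letters removes the dependence on what precedes it, and the pigeonhole principle removes
the dependence on its position. -/

/-! ### Rigid surjections and the Graham-Rothschild theorem -/

/-- `f` restricts to a rigid surjection from `{0, …, N - 1}` onto `{0, …, K - 1}` (the first
occurrences of the values are increasing) that is the identity below `a`; it is extended by `0`. -/
structure RigidSurj (a N K : ℕ) (f : ℕ → ℕ) : Prop where
  lt : ∀ i < N, f i < K
  fixed : ∀ i < a, f i = i
  eq_zero : ∀ i, N ≤ i → f i = 0
  occurs : ∀ v < K, ∃ i < N, f i = v ∧ ∀ j < i, f j < v

/-- The value `a` occurs in `f` for the first time at `p`, and all earlier values are below `a`. -/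
def FirstOcc (a : ℕ) (f : ℕ → ℕ) (p : ℕ) : Prop := f p = a ∧ ∀ j < p, f j < a

/-- The word `u` below `n`, followed by the word `f` from position `j` on. -/
def glueWord (n : ℕ) (u : ℕ → ℕ) (j : ℕ) (f : ℕ → ℕ) : ℕ → ℕ :=
  fun i => if i < n then u i else f (i - n + j)

/-- The Graham-Rothschild property: for every finite colouring of the rigid surjections onto `k`
values which are the identity below `a`, those that factor through a suitable rigid surjection `R`
onto `m` values all have the same colour. -/
def GrahamRothschild (a k : ℕ) : Prop :=
  ∀ (m : ℕ) (C : Type) [Finite C], a ≤ m → ∃ N, ∀ χ : (ℕ → ℕ) → C,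
    ∃ R, RigidSurj a N m R ∧ ∃ c, ∀ f, RigidSurj a m k f → χ (f ∘ R) = c

namespace RigidSurj

variable {a N M K : ℕ} {f g R : ℕ → ℕ}

theorem le_dom (h : RigidSurj a N K f) (haK : a ≤ K) : a ≤ N := by
  rcases Nat.eq_zero_or_pos a with h0 | h0
  · omega
  obtain ⟨i, hi, hv, hlt⟩ := h.occurs (a - 1) (by omega)
  by_contra hN
  have := h.fixed i (by omega)
  omega

/-- The condition `1 ≤ a` gives `f 0 = 0`, so the default value 0 beyond the domain survives
composition. -/
theorem comp (ha : 1 ≤ a) (hf : RigidSurj a M K f) (hR : RigidSurj a N M R) :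
    RigidSurj a N K (f ∘ R) where
  lt i hi := hf.lt _ (hR.lt i hi)
  fixed i hi := by simp [hR.fixed i hi, hf.fixed i hi]
  eq_zero i hi := by simp [hR.eq_zero i hi, hf.fixed 0 ha]
  occurs v hv := by
    obtain ⟨i, hi, hv', hlt⟩ := hf.occurs v hv
    obtain ⟨i', hi', hv'', hlt'⟩ := hR.occurs i hi
    exact ⟨i', hi', by simp [hv'', hv'], fun j hj => hlt _ (hlt' j hj)⟩

theorem truncatedId (haK : a ≤ K) : RigidSurj a K K (fun i => if i < K then i else 0) where
  lt i hi := by simp [hi]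
  fixed i hi := by simp; omega
  eq_zero i hi := by simp; omega
  occurs v hv := ⟨v, hv, by simp [hv], fun j hj => by simp only [hj.trans hv, if_true]; exact hj⟩

theorem firstOcc_lt (hf : RigidSurj a N K f) (ha : 1 ≤ a) {p : ℕ} (hp : FirstOcc a f p) :
    p < N := by
  by_contra h
  have := hf.eq_zero p (by omega)
  have := hp.1
  omega

theorem le_firstOcc (hf : RigidSurj a N K f) {p : ℕ} (hp : FirstOcc a f p) : a ≤ p := by
  by_contra h
  have := hf.fixed p (by omega)
  have := hp.1
  omega

theorem firstOcc_comp (hR : RigidSurj a N M R) {p : ℕ} (hpM : p < M) (hp : FirstOcc a f p) :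
    ∃ q, FirstOcc a (f ∘ R) q ∧ R q = p ∧ ∀ i < q, R i < p := by
  obtain ⟨q, -, hq, hlt⟩ := hR.occurs p hpM
  exact ⟨q, ⟨by simp [hq, hp.1], fun j hj => hp.2 _ (hlt j hj)⟩, hq, hlt⟩

end RigidSurj

theorem FirstOcc.unique {a p q : ℕ} {f : ℕ → ℕ} (hp : FirstOcc a f p) (hq : FirstOcc a f q) :
    p = q := by
  rcases lt_trichotomy p q with h | h | h
  · have := hq.2 p h; have := hp.1; omega
  · exact h
  · have := hp.2 q h; have := hq.1; omega

/-- The multidimensional Hales-Jewett theorem in terms of rigid surjections. -/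
theorem grahamRothschild_self (a : ℕ) (ha : 1 ≤ a) : GrahamRothschild a a := by
  intro m C _ ham
  obtain ⟨t, rfl⟩ := Nat.exists_eq_add_of_le ham
  obtain ⟨n, hn⟩ := Combinatorics.Subspace.exists_mono_in_high_dimension_fin (Fin a) C (Fin t)
  refine ⟨a + n, fun χ => ?_⟩
  obtain ⟨l, c, hc⟩ := hn fun y => χ fun i =>
    if i < a then i else if h : i - a < n then (y ⟨i - a, h⟩ : ℕ) else 0
  have hfirst : ∀ e, ∃ i : Fin n, l.idxFun i = Sum.inr e ∧ ∀ j < i, l.idxFun j ≠ Sum.inr e := by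
    intro e
    have hne : (Finset.univ.filter fun i => l.idxFun i = Sum.inr e).Nonempty := by
      obtain ⟨i, hi⟩ := l.proper e
      exact ⟨i, by simp [hi]⟩
    refine ⟨Finset.min' _ hne, ?_, fun j hj hj' => ?_⟩
    · have := Finset.min'_mem _ hne
      simpa only [Finset.mem_filter, Finset.mem_univ, true_and] using this
    · exact absurd (Finset.min'_le _ j (by simp [hj'])) (not_le.2 hj)
  choose first hfirst hmin using hfirst
  have hinj : Function.Injective first := fun e e' h => by
    have h1 := hfirst e
    rw [h, hfirst e'] at h1
    exact (Sum.inr_injective h1).symm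
  -- Rigidity forces the variables of the subspace to be numbered by their first occurrences.
  -- Constants keep their letter, and the variable of rank `r` receives the value `a + r`.
  let σ := Tuple.sort first
  have hσ : StrictMono (first ∘ σ) :=
    (Tuple.monotone_sort first).strictMono_of_injective (hinj.comp σ.injective)
  let w : Fin a ⊕ Fin t → ℕ := Sum.elim (fun b => (b : ℕ)) fun e => a + (σ.symm e : ℕ)
  let R : ℕ → ℕ := fun i => if i < a then i else if h : i - a < n then w (l.idxFun ⟨i - a, h⟩) else 0
  refine ⟨R, ⟨?_, ?_, ?_, ?_⟩, c, ?_⟩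
  · intro i hi
    by_cases hia : i < a
    · simp only [R, hia, if_true]; omega
    · have h : i - a < n := by omega
      simp only [R, hia, if_false, h, dif_pos]
      rcases l.idxFun ⟨i - a, h⟩ with b | e
      · simp only [w, Sum.elim_inl]; omega
      · simp only [w, Sum.elim_inr]; omega
  · intro i hi
    simp only [R, hi, if_true]
  · intro i hi
    have h1 : ¬ i < a := by omega
    have h2 : ¬ i - a < n := by omega
    simp only [R, h1, h2, if_false, dif_neg, not_false_iff]
  · intro v hv
    by_cases hva : v < a
    · refine ⟨v, by omega, by simp only [R, hva, if_true], fun j hj => ?_⟩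
      have : j < a := by omega
      simp only [R, this, if_true]; omega
    · let i := first (σ ⟨v - a, by omega⟩)
      refine ⟨a + i, by omega, ?_, ?_⟩
      · have h1 : ¬ a + (i : ℕ) < a := by omega
        have h2 : a + (i : ℕ) - a = i := by omega
        simp only [R, h1, if_false, h2, Fin.is_lt, dif_pos, Fin.eta]
        simp only [i, hfirst, w, Sum.elim_inr, Equiv.symm_apply_apply]
        omega
      · intro j hj
        by_cases hja : j < a
        · simp only [R, hja, if_true]; omega
        · have h : j - a < n := by omega
          simp only [R, hja, if_false, h, dif_pos]
          rcases he : l.idxFun ⟨j - a, h⟩ with b | e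
          · simp only [w, Sum.elim_inl]; omega
          · simp only [w, Sum.elim_inr]
            have h1 : first e ≤ ⟨j - a, h⟩ := by
              by_contra hlt
              exact hmin e _ (not_le.1 hlt) he
            have h2 : (⟨j - a, h⟩ : Fin n) < i := by
              rw [Fin.lt_def]; simp only; omega
            have h3 : (first ∘ σ) (σ.symm e) < (first ∘ σ) ⟨v - a, by omega⟩ := by
              simpa using lt_of_le_of_lt h1 h2
            have h4 := hσ.lt_iff_lt.1 h3
            rw [Fin.lt_def] at h4
            simp only at h4
            omega
  · intro f hf
    -- `f ∘ R` is the point of the subspace obtained by substituting `f (a + r)` for the variable of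
    -- rank `r`.
    rw [← hc fun e => ⟨f (a + σ.symm e), hf.lt _ (by omega)⟩]
    congr 1
    funext i
    by_cases hia : i < a
    · simp only [Function.comp, R, hia, if_true]
      exact hf.fixed i hia
    · by_cases h : i - a < n
      · simp only [Function.comp, R, hia, if_false, h, dif_pos, Combinatorics.Subspace.coe_apply]
        rcases l.idxFun ⟨i - a, h⟩ with b | e
        · simp only [w, Sum.elim_inl, id]
          exact hf.fixed _ b.2
        · simp only [w, Sum.elim_inr]
      · simp only [Function.comp, R, hia, if_false, h, dif_neg, not_false_iff]
        exact hf.fixed 0 ha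

/-- The colour of the rigid surjections `f` from `M` onto `k` for which the value `a` first occurs
before `j` depends only on the part of `f` before that occurrence. -/
def PrefixDetermined (a k M j : ℕ) {C : Type} (χ : (ℕ → ℕ) → C) : Prop :=
  ∀ f f', RigidSurj a M k f → RigidSurj a M k f' → ∀ p < j, FirstOcc a f p → FirstOcc a f' p →
    (∀ i < p, f i = f' i) → χ f = χ f'

/-- If `R` first takes the value `p` at `q`, then `R` is below `p` before `q`. So the prefix of `f ∘
R` before `q` only sees the prefix of `f` before `p`. -/
theorem PrefixDetermined.comp {a k M M' : ℕ} (ha : 1 ≤ a) {C : Type} {χ : (ℕ → ℕ) → C}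
    (h : PrefixDetermined a k M M χ) {R : ℕ → ℕ} (hR : RigidSurj a M M' R) :
    PrefixDetermined a k M' M' fun f => χ (f ∘ R) := by
  intro f f' hf hf' p hp hfp hfp' heq
  obtain ⟨q, hq, -, hlt⟩ := hR.firstOcc_comp hp hfp
  obtain ⟨q', hq', hRq', hlt'⟩ := hR.firstOcc_comp hp hfp'
  have hqq : q = q' := by
    have h1 : FirstOcc a (f ∘ R) q' :=
      ⟨by simp [hRq', hfp.1], fun j hj => hfp.2 _ (hlt' j hj)⟩
    exact hq.unique h1
  subst hqq
  exact h _ _ (hf.comp ha hR) (hf'.comp ha hR) q ((hf.comp ha hR).firstOcc_lt ha hq) hq hq'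
    fun i hi => heq _ (hlt i hi)

/-- The identity below `j`, followed by the shift of the values of `R` from position `a` on. -/
def shiftWord (a j : ℕ) (R : ℕ → ℕ) : ℕ → ℕ :=
  fun i => if i < j then i else if R (i - j + a) < a then R (i - j + a) else R (i - j + a) - a + j

theorem RigidSurj.shiftWord {a j L M : ℕ} {R : ℕ → ℕ} (ha : 1 ≤ a) (haj : a ≤ j) (hjM : j < M)
    (hR : RigidSurj (a + 1) L (M - j + a) R) :
    RigidSurj a (L - a + j) M (shiftWord a j R) := by
  have hL := hR.le_dom (by omega)
  refine ⟨fun i hi => ?_, fun i hi => ?_, fun i hi => ?_, fun v hv => ?_⟩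
  · unfold _root_.shiftWord
    split_ifs with h1 h2
    · omega
    · omega
    · have := hR.lt (i - j + a) (by omega)
      omega
  · simp only [_root_.shiftWord, show i < j by omega, if_true]
  · have h1 := hR.eq_zero (i - j + a) (by omega)
    simp only [_root_.shiftWord, h1, show ¬ i < j by omega, if_false, show 0 < a by omega, if_true]
  · by_cases hvj : v < j
    · refine ⟨v, by omega, by simp only [_root_.shiftWord, hvj, if_true], fun i hi => ?_⟩
      simp only [_root_.shiftWord, show i < j by omega, if_true]
      exact hi
    · obtain ⟨i, hi, hiv, hlt⟩ := hR.occurs (v - j + a) (by omega)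
      have hai : a ≤ i := by
        by_contra h
        have := hR.fixed i (by omega)
        omega
      refine ⟨i - a + j, by omega, ?_, fun i' hi' => ?_⟩
      · have e1 : i - a + j - j + a = i := by omega
        simp only [_root_.shiftWord, e1, hiv, show ¬ i - a + j < j by omega, if_false,
          show ¬ v - j + a < a by omega]
        omega
      · unfold _root_.shiftWord
        split_ifs with h1 h2
        · omega
        · omega
        · have := hlt (i' - j + a) (by omega)
          omega

/-- Once `a` has occurred, it can be treated as one more fixed value: the part from `j` on, preceded
by the values below `a`, is an object of the case `a + 1`. -/
theorem RigidSurj.tail {a j M k : ℕ} {f : ℕ → ℕ} (ha : 1 ≤ a) (haj : a ≤ j) (hjM : j < M)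
    (hf : RigidSurj a M k f) (hj : FirstOcc a f j) :
    RigidSurj (a + 1) (M - j + a) k (glueWord a id j f) := by
  have hak : a < k := hj.1 ▸ hf.lt j hjM
  refine ⟨fun i hi => ?_, fun i hi => ?_, fun i hi => ?_, fun v hv => ?_⟩
  · unfold glueWord
    split_ifs with h
    · simp only [id]; omega
    · exact hf.lt _ (by omega)
  · unfold glueWord
    split_ifs with h
    · rfl
    · have : i = a := by omega
      subst this
      simpa using hj.1
  · simp only [glueWord, show ¬ i < a by omega, if_false]
    exact hf.eq_zero _ (by omega)
  · by_cases hva : v < a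
    · refine ⟨v, by omega, by simp [glueWord, hva], fun i hi => ?_⟩
      simp only [glueWord, show i < a by omega, if_true, id]
      exact hi
    · obtain ⟨i, hi, hiv, hlt⟩ := hf.occurs v hv
      have hij : j ≤ i := by
        by_contra h
        have := hj.2 i (by omega)
        omega
      refine ⟨i - j + a, by omega, ?_, fun i' hi' => ?_⟩
      · simp only [glueWord, show ¬ i - j + a < a by omega, if_false]
        rw [← hiv]
        congr 1
        omega
      · unfold glueWord
        split_ifs with h
        · simp only [id]; omega
        · exact hlt _ (by omega)

/-- Composition with `shiftWord` keeps the prefix below `j` and acts on the tail alone, so the case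
`a + 1` can be applied to tails. -/
theorem comp_shiftWord {a j M k : ℕ} {f R : ℕ → ℕ} (hf : RigidSurj a M k f) :
    f ∘ shiftWord a j R = glueWord j f a ((glueWord a id j f) ∘ R) := by
  funext i
  by_cases hij : i < j
  · simp [shiftWord, glueWord, hij]
  · simp only [Function.comp, shiftWord, glueWord, hij, if_false]
    split_ifs with h
    · exact hf.fixed _ h
    · rfl

theorem exists_prefixDetermined {a k : ℕ} (ha : 1 ≤ a) (hGR : GrahamRothschild (a + 1) k)
    (C : Type) [Finite C] (j M : ℕ) (haM : a ≤ M) :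
    ∃ N, ∀ χ : (ℕ → ℕ) → C, ∃ R, RigidSurj a N M R ∧
      PrefixDetermined a k M j fun f => χ (f ∘ R) := by
  induction j generalizing M with
  | zero =>
    exact ⟨M, fun χ => ⟨_, RigidSurj.truncatedId haM,
      fun f f' _ _ p hp => absurd hp (by omega)⟩⟩
  | succ j ih =>
    by_cases hj : a ≤ j ∧ j < M
    · obtain ⟨haj, hjM⟩ := hj
      obtain ⟨L, hL⟩ := hGR (M - j + a) ((Fin j → Fin a) → C) (by omega)
      obtain ⟨N, hN⟩ := ih (L - a + j) (by omega)
      refine ⟨N, fun χ => ?_⟩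
      obtain ⟨R, hR, hRχ⟩ := hN χ
      -- The colour of a tail is a function of all prefixes of length `j` over `a` letters, so one
      -- application of `hGR` treats every prefix simultaneously.
      obtain ⟨R', hR', c, hc⟩ := hL fun s u =>
        χ ((glueWord j (fun i => if h : i < j then (u ⟨i, h⟩ : ℕ) else 0) a s) ∘ R)
      have hS := hR'.shiftWord ha haj hjM
      refine ⟨shiftWord a j R' ∘ R, hS.comp ha hR, ?_⟩
      intro f f' hf hf' p hp hfp hfp' heq
      rcases Nat.lt_succ_iff_lt_or_eq.1 hp with hpj | rfl
      · have key : ∀ i ≤ p, shiftWord a j R' i = i := fun i hi => by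
          simp only [shiftWord, show i < j by omega, if_true]
        refine hRχ _ _ (hf.comp ha hS) (hf'.comp ha hS) p hpj ?_ ?_ ?_
        · exact ⟨by simp [key p le_rfl, hfp.1], fun i hi => by simp [key i hi.le, hfp.2 i hi]⟩
        · exact ⟨by simp [key p le_rfl, hfp'.1], fun i hi => by simp [key i hi.le, hfp'.2 i hi]⟩
        · intro i hi
          simp [key i hi.le, heq i hi]
      · have main : ∀ g (hg : RigidSurj a M k g) (hgp : FirstOcc a g p),
            χ (g ∘ shiftWord a p R' ∘ R) = c fun i => ⟨g i, hgp.2 i i.2⟩ := by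
          intro g hg hgp
          rw [← hc _ (hg.tail ha haj hjM hgp), ← Function.comp_assoc,
            comp_shiftWord hg]
          congr 2
          funext i
          simp only [glueWord]
          split_ifs <;> rfl
        change χ (f ∘ shiftWord a p R' ∘ R) = χ (f' ∘ shiftWord a p R' ∘ R)
        rw [main f hf hfp, main f' hf' hfp']
        congr 1
        funext i
        exact Fin.ext (heq i i.2)
    -- No admissible word has its first `a` at `j` here, so nothing new is required.
    · obtain ⟨N, hN⟩ := ih M haM
      refine ⟨N, fun χ => ?_⟩
      obtain ⟨R, hR, hRχ⟩ := hN χ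
      refine ⟨R, hR, fun f f' hf hf' p hp hfp hfp' heq => ?_⟩
      have h1 := hf.firstOcc_lt ha hfp
      have h2 := hf.le_firstOcc hfp
      exact hRχ f f' hf hf' p (by omega) hfp hfp' heq

/-! ### Modifying the prefix before the first occurrence of `a` -/

theorem RigidSurj.append_id {a n j : ℕ} {R : ℕ → ℕ} (hR : RigidSurj a n j R) (han : a ≤ n)
    (t : ℕ) :
    RigidSurj a (n + t) (j + t) (glueWord n R j fun x => if x < j + t then x else 0) := by
  refine ⟨fun x hx => ?_, fun x hx => ?_, fun x hx => ?_, fun v hv => ?_⟩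
  · simp only [glueWord]
    split_ifs with h1 h2
    · have := hR.lt x h1; omega
    · exact h2
    · omega
  · simp only [glueWord, show x < n by omega, if_true]
    exact hR.fixed x hx
  · simp only [glueWord, show ¬ x < n by omega, if_false, ite_eq_right_iff]
    omega
  · by_cases hvj : v < j
    · obtain ⟨x, hx, hxv, hlt⟩ := hR.occurs v hvj
      refine ⟨x, by omega, by simp [glueWord, hx, hxv], fun y hy => ?_⟩
      simp only [glueWord, show y < n by omega, if_true]
      exact hlt y hy
    · refine ⟨v - j + n, by omega, ?_, fun y hy => ?_⟩
      · simp only [glueWord, show ¬ v - j + n < n by omega, if_false,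
          show v - j + n - n + j = v by omega, hv, if_true]
      · simp only [glueWord]
        split_ifs with h1 h2
        · have := hR.lt y h1; omega
        · omega
        · omega

theorem RigidSurj.glue {a p M k : ℕ} {f g : ℕ → ℕ} (hap : a ≤ p) (hpM : p < M)
    (hf : RigidSurj a M k f) (hg : RigidSurj a M k g) (hfp : FirstOcc a f p)
    (hgp : FirstOcc a g p) : RigidSurj a M k (glueWord p g p f) := by
  refine ⟨fun x hx => ?_, fun x hx => ?_, fun x hx => ?_, fun v hv => ?_⟩
  · unfold glueWord
    split_ifs with h
    · exact hg.lt x hx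
    · exact hf.lt _ (by omega)
  · simp only [glueWord, show x < p by omega, if_true]; exact hg.fixed x hx
  · simp only [glueWord, show ¬ x < p by omega, if_false]
    exact hf.eq_zero _ (by omega)
  · by_cases hva : v < a
    · refine ⟨v, by omega, ?_, fun y hy => ?_⟩
      · simp only [glueWord, show v < p by omega, if_true]; exact hg.fixed v hva
      · simp only [glueWord, show y < p by omega, if_true]
        rw [hg.fixed y (by omega)]; exact hy
    · obtain ⟨x, hx, hxv, hlt⟩ := hf.occurs v hv
      have hpx : p ≤ x := by
        by_contra h
        have := hfp.2 x (by omega)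
        omega
      refine ⟨x, hx, ?_, fun y hy => ?_⟩
      · simp only [glueWord, show ¬ x < p by omega, if_false, show x - p + p = x by omega, hxv]
      · unfold glueWord
        split_ifs with h
        · have := hgp.2 y h; omega
        · rw [show y - p + p = y by omega]
          exact hlt y hy

theorem RigidSurj.truncate {a p M k : ℕ} {g : ℕ → ℕ} (hap : a ≤ p) (hg : RigidSurj a M k g)
    (hgp : FirstOcc a g p) : RigidSurj a p a fun x => if x < p then g x else 0 := by
  refine ⟨fun x hx => ?_, fun x hx => ?_, fun x hx => ?_, fun v hv => ?_⟩
  · simp only [hx, if_true]; exact hgp.2 x hx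
  · simp only [show x < p by omega, if_true]; exact hg.fixed x hx
  · simp only [show ¬ x < p by omega, if_false]
  · refine ⟨v, by omega, ?_, fun y hy => ?_⟩
    · simp only [show v < p by omega, if_true]; exact hg.fixed v hv
    · simp only [show y < p by omega, if_true]
      rw [hg.fixed y (by omega)]; exact hy

/-- Colours determined by the part before the first occurrence of `a` can be made to depend only on
the position of that occurrence, if it is among the last `i` positions. -/
theorem exists_firstOccDetermined {a : ℕ} (ha : 1 ≤ a) (k : ℕ) (C : Type) [Finite C] (i M' : ℕ)
    (haM : a ≤ M') :
    ∃ M, ∀ χ : (ℕ → ℕ) → C, PrefixDetermined a k M M χ → ∃ R, RigidSurj a M M' R ∧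
      ∀ f f', RigidSurj a M' k f → RigidSurj a M' k f' → ∀ p, M' ≤ p + i →
        FirstOcc a f p → FirstOcc a f' p → χ (f ∘ R) = χ (f' ∘ R) := by
  induction i generalizing M' with
  | zero =>
    refine ⟨M', fun χ _ => ⟨_, RigidSurj.truncatedId haM, fun f f' hf _ p hp hfp => ?_⟩⟩
    exact absurd (hf.firstOcc_lt ha hfp) (by omega)
  | succ i ih =>
    by_cases hj : a ≤ M' - (i + 1)
    · obtain ⟨j, rfl⟩ : ∃ j, M' = j + (i + 1) := ⟨M' - (i + 1), by omega⟩
      have haj : a ≤ j := by omega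
      clear hj
      obtain ⟨n, hn⟩ := grahamRothschild_self a ha j C haj
      -- The bound is read off from any instance of `hn`, which needs a colour to exist. Without
      -- colours there is no colouring to treat.
      have han : a ≤ n ∨ IsEmpty C := by
        rcases isEmpty_or_nonempty C with h | ⟨⟨c⟩⟩
        · exact Or.inr h
        · obtain ⟨R, hR, -⟩ := hn fun _ => c
          exact Or.inl (hR.le_dom haj)
      rcases han with han | hC
      swap
      · exact ⟨0, fun χ => hC.elim (χ id)⟩
      obtain ⟨M, hM⟩ := ih (n + (i + 1)) (by omega)
      refine ⟨M, fun χ hχ => ?_⟩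
      obtain ⟨R, hR, hRχ⟩ := hM χ hχ
      have hχR := hχ.comp ha hR
      -- A reference word with its first `a` at `j`, if there is one. Its tail completes every
      -- prefix, so that Hales-Jewett can colour the prefixes alone.
      obtain ⟨f₀, hf₀⟩ : ∃ f₀, ∀ g, RigidSurj a (j + (i + 1)) k g → FirstOcc a g j →
          RigidSurj a (j + (i + 1)) k f₀ ∧ FirstOcc a f₀ j := by
        by_cases hex : ∃ f₀, RigidSurj a (j + (i + 1)) k f₀ ∧ FirstOcc a f₀ j
        · exact hex.imp fun f₀ h _ _ _ => h
        · exact ⟨id, fun g hg hgj => absurd ⟨g, hg, hgj⟩ hex⟩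
      obtain ⟨R', hR', c, hc⟩ := hn fun u => χ (glueWord n u j f₀ ∘ R)
      have hS := hR'.append_id han (i + 1)
      set S := glueWord n R' j fun x => if x < j + (i + 1) then x else 0 with hSdef
      have hSlow : ∀ x < n, S x = R' x := fun x hx => by simp [hSdef, glueWord, hx]
      have hShigh : ∀ x, j ≤ x → x < j + (i + 1) → S (x - j + n) = x := fun x hx hx' => by
        simp only [hSdef, glueWord, show ¬ x - j + n < n by omega, if_false,
          show x - j + n - n + j = x by omega, hx', if_true]
      have hShift : ∀ g p, j ≤ p → p < j + (i + 1) → FirstOcc a g p →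
          FirstOcc a (g ∘ S) (p - j + n) := by
        intro g p hp hp' hg
        refine ⟨by simp [hShigh p hp hp', hg.1], fun y hy => ?_⟩
        by_cases hyn : y < n
        · have := hR'.lt y hyn
          simp only [Function.comp, hSlow y hyn]
          exact hg.2 _ (by omega)
        · have := hShigh (y - n + j) (by omega) (by omega)
          rw [show y - n + j - j + n = y by omega] at this
          simp only [Function.comp, this]
          exact hg.2 _ (by omega)
      refine ⟨S ∘ R, hS.comp ha hR, fun f f' hf hf' p hp hfp hfp' => ?_⟩
      rcases Nat.lt_or_ge j p with hjp | hjp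
      · have hpM := hf.firstOcc_lt ha hfp
        exact hRχ _ _ (hf.comp ha hS) (hf'.comp ha hS) (p - j + n) (by omega)
          (hShift f p hjp.le hpM hfp) (hShift f' p hjp.le hpM hfp')
      · obtain rfl : p = j := by omega
        have main : ∀ g, RigidSurj a (p + (i + 1)) k g → FirstOcc a g p → χ (g ∘ S ∘ R) = c := by
          intro g hg hgp
          obtain ⟨hf₀, hf₀p⟩ := hf₀ g hg hgp
          have hh := hf₀.glue haj (by omega) hg hf₀p hgp
          have hhp : FirstOcc a (glueWord p g p f₀) p :=
            ⟨by simp [glueWord, hf₀p.1], fun y hy => by simp [glueWord, hy, hgp.2 y hy]⟩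
          -- The colour is prefix determined, so the tail of `g` may be replaced by that of `f₀`.
          have e1 : χ ((g ∘ S) ∘ R) = χ ((glueWord p g p f₀ ∘ S) ∘ R) := by
            refine hχR _ _ (hg.comp ha hS) (hh.comp ha hS) n (by omega) ?_ ?_ ?_
            · simpa using hShift g p le_rfl (by omega) hgp
            · simpa using hShift _ p le_rfl (by omega) hhp
            · intro x hx
              have := hR'.lt x hx
              simp [hSlow x hx, glueWord, this]
          rw [← Function.comp_assoc, e1, ← hc _ (hg.truncate haj hgp)]
          congr 2
          funext x
          by_cases hx : x < n
          · have := hR'.lt x hx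
            simp [hSlow x hx, glueWord, hx, this]
          · by_cases h1 : x - n + p < p + (i + 1)
            · have h2 := hShigh (x - n + p) (by omega) h1
              rw [show x - n + p - p + n = x by omega] at h2
              simp [h2, glueWord, hx]
            · have h2 : S x = 0 := hS.eq_zero x (by omega)
              simp only [Function.comp, h2, glueWord, hx, if_false, show 0 < p by omega, if_true]
              rw [hg.fixed 0 ha, hf₀.eq_zero _ (by omega)]
        change χ (f ∘ S ∘ R) = χ (f' ∘ S ∘ R)
        rw [main f hf hfp, main f' hf' hfp']
    · obtain ⟨M, hM⟩ := ih M' haM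
      refine ⟨M, fun χ hχ => ?_⟩
      obtain ⟨R, hR, hRχ⟩ := hM χ hχ
      refine ⟨R, hR, fun f f' hf hf' p hp hfp hfp' => ?_⟩
      have h2 := hf.le_firstOcc hfp
      exact hRχ f f' hf hf' p (by omega) hfp hfp'

/-- The rigid surjection that puts the values `a, a + 1, …` at the positions in `s` and `0` at the
other positions from `a` on. -/
theorem RigidSurj.exists_of_finset {a M : ℕ} (ha : 1 ≤ a) (haM : a ≤ M) (s : Finset ℕ)
    (hs : ∀ i ∈ s, a ≤ i ∧ i < M) :
    ∃ R, RigidSurj a M (a + s.card) R ∧ ∀ i, a ≤ R i → i ∈ s := by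
  have hfin : {i | i ∈ s}.Finite := s.finite_toSet
  have hcard : hfin.toFinset.card = s.card := by
    congr 1
    exact s.finite_toSet_toFinset
  have hcount : ∀ i ∈ s, Nat.count (· ∈ s) i < s.card := by
    intro i hi
    rw [Nat.count_eq_card_filter_range]
    refine Finset.card_lt_card ⟨fun x hx => (Finset.mem_filter.1 hx).2, fun h => ?_⟩
    have := h hi
    simp at this
  refine ⟨fun i => if i < a then i else if i ∈ s then a + Nat.count (· ∈ s) i else 0,
    ⟨fun i hi => ?_, fun i hi => ?_, fun i hi => ?_, fun v hv => ?_⟩, fun i hi => ?_⟩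
  · split_ifs with h1 h2
    · omega
    · have := hcount i h2; omega
    · omega
  · simp [hi]
  · have h2 : i ∉ s := fun h => by have := hs i h; omega
    simp only [show ¬ i < a by omega, if_false, h2]
  · by_cases hva : v < a
    · refine ⟨v, by omega, by simp [hva], fun j hj => ?_⟩
      simp only [show j < a by omega, if_true]
      exact hj
    · have hlt : v - a < hfin.toFinset.card := by omega
      have hmem : Nat.nth (· ∈ s) (v - a) ∈ s := Nat.nth_mem_of_lt_card hfin hlt
      have hcn : Nat.count (· ∈ s) (Nat.nth (· ∈ s) (v - a)) = v - a :=
        Nat.count_nth_of_lt_card_finite hfin hlt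
      obtain ⟨h1, h2⟩ := hs _ hmem
      refine ⟨_, h2, ?_, fun j hj => ?_⟩
      · simp only [show ¬ Nat.nth (· ∈ s) (v - a) < a by omega, if_false, hmem, if_true, hcn]
        omega
      · split_ifs with h3 h4
        · omega
        · have : Nat.count (· ∈ s) j < Nat.count (· ∈ s) (Nat.nth (· ∈ s) (v - a)) :=
            Nat.count_strict_mono h4 hj
          omega
        · omega
  · simp only at hi
    split_ifs at hi with h1 h2
    · omega
    · exact h2
    · omega

/-- After the two reductions the colour is a function `d` of the position of the first `a`. A
further rigid surjection confines that position to a set on which `d` is constant. -/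
theorem GrahamRothschild.of_succ {a k : ℕ} (ha : 1 ≤ a) (hak : a < k)
    (hGR : GrahamRothschild (a + 1) k) : GrahamRothschild a k := by
  classical
  intro m C _ ham
  obtain ⟨t, rfl⟩ := Nat.exists_eq_add_of_le ham
  have := Fintype.ofFinite C
  -- There are `card C * t` positions from `a` on, enough for `t` of them to share a colour. Taking
  -- the whole length as the number of last positions covers all of them.
  obtain ⟨M₂, hM₂⟩ := exists_firstOccDetermined ha k C (a + Fintype.card C * t)
    (a + Fintype.card C * t) (by omega)
  by_cases haM : a ≤ M₂
  swap
  · refine ⟨0, fun χ => ?_⟩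
    obtain ⟨R, hR, -⟩ := hM₂ (fun _ => χ id) fun _ _ _ _ _ _ _ _ _ => rfl
    exact absurd (hR.le_dom (by omega)) haM
  obtain ⟨N, hN⟩ := exists_prefixDetermined ha hGR C M₂ M₂ haM
  refine ⟨N, fun χ => ?_⟩
  obtain ⟨R₁, hR₁, hχ₁⟩ := hN χ
  obtain ⟨R₂, hR₂, hχ₂⟩ := hM₂ _ hχ₁
  have hd : ∃ d : ℕ → C, ∀ f p, RigidSurj a (a + Fintype.card C * t) k f → FirstOcc a f p →
      χ ((f ∘ R₂) ∘ R₁) = d p := by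
    refine ⟨fun p => if h : ∃ f, RigidSurj a (a + Fintype.card C * t) k f ∧ FirstOcc a f p then
      χ ((h.choose ∘ R₂) ∘ R₁) else χ id, fun f p hf hfp => ?_⟩
    have h : ∃ f, RigidSurj a (a + Fintype.card C * t) k f ∧ FirstOcc a f p := ⟨f, hf, hfp⟩
    simp only [dif_pos h]
    exact hχ₂ _ _ hf h.choose_spec.1 p (by omega) hfp h.choose_spec.2
  obtain ⟨d, hd⟩ := hd
  have : Nonempty C := ⟨χ id⟩
  obtain ⟨c, -, hc⟩ := Finset.exists_le_card_fiber_of_mul_le_card_of_maps_to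
    (s := Finset.Ico a (a + Fintype.card C * t)) (t := (Finset.univ : Finset C)) (f := d) (n := t)
    (fun _ _ => Finset.mem_univ _) Finset.univ_nonempty (by simp)
  obtain ⟨s, hs, hst⟩ := Finset.exists_subset_card_eq hc
  have hsd : ∀ i ∈ s, (a ≤ i ∧ i < a + Fintype.card C * t) ∧ d i = c := fun i hi => by
    simpa using hs hi
  obtain ⟨R₃, hR₃, hR₃s⟩ := RigidSurj.exists_of_finset ha (by omega) s fun i hi => (hsd i hi).1
  rw [hst] at hR₃
  refine ⟨R₃ ∘ R₂ ∘ R₁, hR₃.comp ha (hR₂.comp ha hR₁), ?_⟩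
  refine ⟨c, fun f hf => ?_⟩
  have hg := hf.comp ha hR₃
  obtain ⟨p, -, hp⟩ := hg.occurs a hak
  change χ (((f ∘ R₃) ∘ R₂) ∘ R₁) = c
  rw [hd _ p hg hp]
  refine (hsd p (hR₃s p ?_)).2
  -- If `R₃ p` were below `a`, then `f` would fix it and could not take the value `a` there.
  by_contra h
  have h1 := hf.fixed (R₃ p) (by omega)
  have h2 : f (R₃ p) = a := hp.1
  omega

theorem grahamRothschild {a k : ℕ} (ha : 1 ≤ a) (hak : a ≤ k) : GrahamRothschild a k := by
  induction hak using Nat.decreasingInduction with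
  | self => exact grahamRothschild_self k (by omega)
  | of_succ a _ ih => exact (ih (by omega)).of_succ ha ‹_›

/-! ### Topology of the space of maximal chains -/

section MaximalChains

variable {X : Type*} [TopologicalSpace X]

theorem NonemptyCompacts.isClosed_le [T2Space X] :
    IsClosed {p : NonemptyCompacts X × NonemptyCompacts X | p.1 ≤ p.2} := by
  rw [← isOpen_compl_iff, isOpen_iff_forall_mem_open]
  rintro ⟨K, L⟩ h
  obtain ⟨x, hxK, hxL⟩ := Set.not_subset.1 h
  obtain ⟨U, V, hU, hV, hxU, hLV, hUV⟩ :=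
    (SeparatedNhds.of_isCompact_isCompact isCompact_singleton L.isCompact
      (Set.disjoint_singleton_left.2 hxL))
  refine ⟨{K : NonemptyCompacts X | ((K : Set X) ∩ U).Nonempty} ×ˢ
    {L : NonemptyCompacts X | (L : Set X) ⊆ V}, ?_,
    (NonemptyCompacts.isOpen_inter_nonempty_of_isOpen hU).prod
      (NonemptyCompacts.isOpen_subsets_of_isOpen hV), ⟨x, hxK, hxU rfl⟩, hLV⟩
  rintro ⟨K', L'⟩ ⟨⟨y, hyK, hyU⟩, hL'⟩ hle
  exact Set.disjoint_left.1 hUV hyU (hL' (hle hyK))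

theorem NonemptyCompacts.isClosed_comparable [T2Space X] :
    IsClosed {p : NonemptyCompacts X × NonemptyCompacts X | p.1 ≤ p.2 ∨ p.2 ≤ p.1} :=
  isClosed_le.union (isClosed_le.preimage continuous_swap)

namespace MaximalChain

/-- By `firstHit_ne` the inclusion of first hits is strict, so some member meeting `D` omits a point
of `firstHit E`, and such a member cannot meet `E`. The induced order thus becomes a condition on a
single member, which the Vietoris topology detects. -/
theorem exists_mem_of_inducedLE [CompactSpace X] [T2Space X] (c : MaximalChain X) {D E : Set X}
    (hD : IsClopen D) (hE : IsClopen E) (hDne : D.Nonempty) (hEne : E.Nonempty)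
    (hDE : Disjoint D E) (h : c.InducedLE D E) :
    ∃ M ∈ c.members, ((M : Set X) ∩ D).Nonempty ∧ (M : Set X) ⊆ Eᶜ := by
  have hne : ¬ c.firstHit E ⊆ c.firstHit D := fun h' =>
    c.firstHit_ne hD hE hDne hEne hDE (h.antisymm h')
  obtain ⟨x, hxE, hxD⟩ := Set.not_subset.1 hne
  simp only [firstHit, Set.mem_iInter] at hxD
  push Not at hxD
  obtain ⟨M, ⟨hM, hMD⟩, hxM⟩ := hxD
  refine ⟨M, hM, hMD, fun y hy hyE => hxM ?_⟩
  exact Set.mem_iInter₂.1 hxE M ⟨hM, y, hy, hyE⟩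

theorem firstHit_subset_of_mem (c : MaximalChain X) {D : Set X} {M : NonemptyCompacts X}
    (hM : M ∈ c.members) (hMD : ((M : Set X) ∩ D).Nonempty) : c.firstHit D ⊆ M :=
  Set.iInter₂_subset M ⟨hM, hMD⟩

theorem firstHit_anti (c : MaximalChain X) {D E : Set X} (h : D ⊆ E) :
    c.firstHit E ⊆ c.firstHit D :=
  Set.subset_iInter₂ fun _ hM =>
    c.firstHit_subset_of_mem hM.1 (hM.2.mono (Set.inter_subset_inter_right _ h))

theorem disjoint_firstHit [CompactSpace X] [T2Space X] (c : MaximalChain X) {D E : Set X}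
    (hD : IsClopen D) (hE : IsClopen E) (hDne : D.Nonempty) (hEne : E.Nonempty)
    (hDE : Disjoint D E) (h : c.InducedLE D E) : Disjoint (c.firstHit D) E := by
  obtain ⟨M, hM, hMD, hME⟩ := c.exists_mem_of_inducedLE hD hE hDne hEne hDE h
  exact Set.disjoint_left.2 fun x hx hxE => hME (c.firstHit_subset_of_mem hM hMD hx) hxE

end MaximalChain

/-! ### Compactness and nonemptiness of the space of maximal chains -/

theorem exists_isClopen_mem_disjoint [CompactSpace X] [T2Space X]
    (hX : IsTopologicalBasis {U : Set X | IsClopen U}) {x : X} {F : Set X} (hF : IsClosed F)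
    (hx : x ∉ F) : ∃ U, IsClopen U ∧ x ∈ U ∧ Disjoint U F := by
  obtain ⟨U, hU, hxU, hUF⟩ := hX.exists_subset_of_mem_open (show x ∈ Fᶜ from hx) hF.isOpen_compl
  exact ⟨U, hU, hxU, Set.disjoint_left.2 hUF⟩

theorem IsMaxChain.exists_mem_iff_not [CompactSpace X] [T2Space X]
    {c : Set (NonemptyCompacts X)} (hc : IsMaxChain (· ≤ ·) c) (hcl : IsClosed c)
    {D E : Set X} (hD : IsClopen D) (hE : IsClopen E) (hDne : D.Nonempty) (hEne : E.Nonempty)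
    (hDE : Disjoint D E) :
    ∃ M ∈ c, (((M : Set X) ∩ D).Nonempty ∧ (M : Set X) ⊆ Eᶜ) ∨
      (((M : Set X) ∩ E).Nonempty ∧ (M : Set X) ⊆ Dᶜ) := by
  have : Nonempty X := ⟨hDne.some⟩
  let c' : MaximalChain X := ⟨⟨⟨c, hcl.isCompact⟩, ⟨_, hc.top_mem⟩⟩, hc⟩
  rcases c'.inducedLE_total D E with h | h
  · obtain ⟨M, hM, h⟩ := c'.exists_mem_of_inducedLE hD hE hDne hEne hDE h
    exact ⟨M, hM, Or.inl h⟩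
  · obtain ⟨M, hM, h⟩ := c'.exists_mem_of_inducedLE hE hD hEne hDne hDE.symm h
    exact ⟨M, hM, Or.inr h⟩

/-- A nonempty compact set has an extremal element for every relation which is a total preorder on
it and has closed sections. -/
theorem IsCompact.exists_forall_rel {Y : Type*} [TopologicalSpace Y] [T2Space Y] {s : Set Y}
    (hs : IsCompact s) (hne : s.Nonempty) (r : Y → Y → Prop) (hr : ∀ a, IsClosed {b | r a b})
    (htrans : ∀ a b c, r a b → r b c → r a c) (htotal : ∀ a ∈ s, ∀ b ∈ s, r a b ∨ r b a) :
    ∃ b ∈ s, ∀ a ∈ s, r a b := by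
  have : Nonempty s := hne.to_subtype
  have hrefl : ∀ a ∈ s, r a a := fun a ha => (htotal a ha a ha).elim id id
  have h := IsCompact.nonempty_iInter_of_directed_nonempty_isCompact_isClosed
    (fun a : s => s ∩ {b | r a b}) ?_ (fun a => ⟨a, a.2, hrefl a a.2⟩)
    (fun a => hs.inter_right (hr a)) (fun a => hs.isClosed.inter (hr a))
  · obtain ⟨b, hb⟩ := h
    rw [Set.mem_iInter] at hb
    exact ⟨b, (hb ⟨_, hne.some_mem⟩).1, fun a ha => (hb ⟨a, ha⟩).2⟩
  · intro a b
    rcases htotal a a.2 b b.2 with h | h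
    · exact ⟨b, fun x hx => ⟨hx.1, htrans _ _ _ h hx.2⟩, fun x hx => hx⟩
    · exact ⟨a, fun x hx => hx, fun x hx => ⟨hx.1, htrans _ _ _ h hx.2⟩⟩

/-- A closed chain containing the whole space is maximal if it separates disjoint clopen sets. -/
theorem isMaxChain_of_separates [CompactSpace X] [T2Space X] [Nonempty X]
    (hX : IsTopologicalBasis {U : Set X | IsClopen U}) {c : Set (NonemptyCompacts X)}
    (hcl : IsClosed c) (hchain : IsChain (· ≤ ·) c) (htop : ⊤ ∈ c)
    (hsep : ∀ D E : Set X, IsClopen D → IsClopen E → D.Nonempty → E.Nonempty → Disjoint D E →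
      ∃ M ∈ c, (((M : Set X) ∩ D).Nonempty ∧ (M : Set X) ⊆ Eᶜ) ∨
        (((M : Set X) ∩ E).Nonempty ∧ (M : Set X) ⊆ Dᶜ)) : IsMaxChain (· ≤ ·) c := by
  refine ⟨hchain, fun d hd hcd => hcd.antisymm fun K hK => ?_⟩
  by_contra hKc
  have hcomp : ∀ M ∈ c, M ≤ K ∨ K ≤ M := fun M hM => hd.total (hcd hM) hK
  have hup : ∀ K : NonemptyCompacts X, IsClosed {M | K ≤ M} := fun K =>
    NonemptyCompacts.isClosed_le.preimage (Continuous.prodMk_right K)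
  have hdown : ∀ K : NonemptyCompacts X, IsClosed {M | M ≤ K} := fun K =>
    NonemptyCompacts.isClosed_le.preimage (Continuous.prodMk_left K)
  -- `B` is the least member above `K`, and `A` below is the greatest member under `K`, or empty.
  -- With `x` in `K \ A` and `y` in `B \ K`, a member separating clopen neighbourhoods of `x` and
  -- `y` would lie strictly between `A` and `B`.
  obtain ⟨B, ⟨hBc, hKB⟩, hB⟩ := (hcl.inter (hup K)).isCompact.exists_forall_rel
    ⟨⊤, htop, Set.subset_univ (K : Set X)⟩ (fun M N => N ≤ M) hdown
    (fun _ _ _ h h' => h'.trans h) (fun M hM N hN => (hchain.total hM.1 hN.1).symm)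
  obtain ⟨A, hAcl, hA, x, hxK, hxA⟩ : ∃ A : Set X, IsClosed A ∧
      (∀ M ∈ c, M ≤ K → (M : Set X) ⊆ A) ∧ ∃ x ∈ K, x ∉ A := by
    by_cases hne : ∃ M ∈ c, M ≤ K
    · obtain ⟨A, ⟨hAc, hAK⟩, hA⟩ := (hcl.inter (hdown K)).isCompact.exists_forall_rel hne
        (fun M N => M ≤ N) hup (fun _ _ _ h h' => h.trans h')
        (fun M hM N hN => hchain.total hM.1 hN.1)
      refine ⟨A, A.isCompact.isClosed, fun M hM hMK => hA M ⟨hM, hMK⟩, Set.not_subset.1 fun h => ?_⟩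
      have hKA : K = A := le_antisymm h hAK
      exact hKc (hKA ▸ hAc)
    · obtain ⟨x, hx⟩ := K.nonempty
      exact ⟨∅, isClosed_empty, fun M hM hMK => absurd ⟨M, hM, hMK⟩ hne, x, hx, id⟩
  obtain ⟨y, hyB, hyK⟩ : ∃ y ∈ B, y ∉ K :=
    Set.not_subset.1 fun h => by
      have hKB' : K = B := le_antisymm hKB h
      exact hKc (hKB' ▸ hBc)
  obtain ⟨E, hE, hyE, hEK⟩ := exists_isClopen_mem_disjoint hX K.isCompact.isClosed hyK
  obtain ⟨D', hD', hxD', hDA⟩ := exists_isClopen_mem_disjoint hX hAcl hxA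
  have hxE : x ∉ E := fun h => Set.disjoint_left.1 hEK h hxK
  obtain ⟨M, hM, h⟩ := hsep (D' \ E) E (hD'.diff hE) hE ⟨x, hxD', hxE⟩ ⟨y, hyE⟩
    Set.disjoint_sdiff_left
  rcases hcomp M hM with hMK | hMK
  · have hMA := hA M hM hMK
    rcases h with ⟨⟨z, hzM, hzD⟩, -⟩ | ⟨⟨z, hzM, hzE⟩, -⟩
    · exact Set.disjoint_left.1 hDA hzD.1 (hMA hzM)
    · exact Set.disjoint_left.1 hEK hzE (hMK hzM)
  · rcases h with ⟨-, h⟩ | ⟨-, h⟩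
    · exact h (hB M ⟨hM, hMK⟩ hyB) hyE
    · exact h (hMK hxK) ⟨hxD', hxE⟩

/-- Maximality is equivalent to being a chain, containing the whole space and separating each pair
of disjoint nonempty clopen sets. Each of these conditions is closed in the Vietoris topology. -/
theorem isClosed_isMaxChain [CompactSpace X] [T2Space X] [Nonempty X]
    (hX : IsTopologicalBasis {U : Set X | IsClopen U}) :
    IsClosed {c : NonemptyCompacts (NonemptyCompacts X) |
      IsMaxChain (· ≤ ·) (c : Set (NonemptyCompacts X))} := by
  have hset : {c : NonemptyCompacts (NonemptyCompacts X) |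
      IsMaxChain (· ≤ ·) (c : Set (NonemptyCompacts X))} =
      {c : NonemptyCompacts (NonemptyCompacts X) |
        IsChain (· ≤ ·) (c : Set (NonemptyCompacts X))} ∩
      ({c : NonemptyCompacts (NonemptyCompacts X) | ((c : Set (NonemptyCompacts X)) ∩ {⊤}).Nonempty} ∩
      ⋂ (p : Set X × Set X) (_ : IsClopen p.1 ∧ IsClopen p.2 ∧ p.1.Nonempty ∧ p.2.Nonempty ∧
        Disjoint p.1 p.2), {c : NonemptyCompacts (NonemptyCompacts X) | ((c : Set (NonemptyCompacts X)) ∩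
          {M | (((M : Set X) ∩ p.1).Nonempty ∧ (M : Set X) ⊆ p.2ᶜ) ∨
            (((M : Set X) ∩ p.2).Nonempty ∧ (M : Set X) ⊆ p.1ᶜ)}).Nonempty}) := by
    ext c
    refine ⟨fun hc => ⟨hc.1, ⟨⊤, hc.top_mem, rfl⟩, Set.mem_iInter₂.2 ?_⟩,
      fun ⟨h1, ⟨M, hM, hMtop⟩, h3⟩ => ?_⟩
    · rintro ⟨D, E⟩ ⟨hD, hE, hDne, hEne, hDE⟩
      exact IsMaxChain.exists_mem_iff_not hc c.isCompact.isClosed hD hE hDne hEne hDE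
    · refine isMaxChain_of_separates hX c.isCompact.isClosed h1 (hMtop ▸ hM) ?_
      intro D E hD hE hDne hEne hDE
      exact Set.mem_iInter₂.1 h3 (D, E) ⟨hD, hE, hDne, hEne, hDE⟩
  rw [hset]
  refine IsClosed.inter ?_ (IsClosed.inter ?_ ?_)
  · rw [← isOpen_compl_iff, isOpen_iff_forall_mem_open]
    intro c hc
    have hex : ∃ K ∈ c, ∃ L ∈ c, ¬ (K ≤ L ∨ L ≤ K) := by
      by_contra! h
      exact hc fun K hK L hL _ => h K hK L hL
    obtain ⟨K, hK, L, hL, hKL⟩ := hex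
    obtain ⟨U, V, hU, hV, hKU, hLV, hUV⟩ := isOpen_prod_iff.1
      NonemptyCompacts.isClosed_comparable.isOpen_compl K L hKL
    refine ⟨_, ?_, (NonemptyCompacts.isOpen_inter_nonempty_of_isOpen hU).inter
      (NonemptyCompacts.isOpen_inter_nonempty_of_isOpen hV), ⟨K, hK, hKU⟩, ⟨L, hL, hLV⟩⟩
    rintro c' ⟨⟨K', hK', hKU'⟩, ⟨L', hL', hLV'⟩⟩ hc'
    exact hUV (Set.mk_mem_prod hKU' hLV') (hc'.total hK' hL')
  · exact NonemptyCompacts.isClosed_inter_nonempty_of_isClosed isClosed_singleton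
  · refine isClosed_biInter fun p hp => NonemptyCompacts.isClosed_inter_nonempty_of_isClosed ?_
    obtain ⟨hD, hE, -⟩ := hp
    exact ((NonemptyCompacts.isClosed_inter_nonempty_of_isClosed hD.1).inter
      (NonemptyCompacts.isClosed_subsets_of_isClosed hE.compl.1)).union
      ((NonemptyCompacts.isClosed_inter_nonempty_of_isClosed hE.1).inter
      (NonemptyCompacts.isClosed_subsets_of_isClosed hD.compl.1))

theorem MaximalChain.compactSpace [CompactSpace X] [T2Space X] [Nonempty X]
    (hX : IsTopologicalBasis {U : Set X | IsClopen U}) : CompactSpace (MaximalChain X) :=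
  isCompact_iff_compactSpace.1 (isClosed_isMaxChain hX).isCompact

/-- Comparability is a closed relation, so the closure of a chain is a chain and a maximal chain
given by Zorn's lemma is closed. -/
theorem MaximalChain.nonempty [CompactSpace X] [T2Space X] [Nonempty X] :
    Nonempty (MaximalChain X) := by
  obtain ⟨c, hc⟩ : ∃ c : Set (NonemptyCompacts X), IsMaxChain (· ≤ ·) c := ⟨_, maxChain_spec⟩
  have hchain : IsChain (· ≤ ·) (closure c) := by
    have hsub : c ×ˢ c ⊆ {p : NonemptyCompacts X × NonemptyCompacts X | p.1 ≤ p.2 ∨ p.2 ≤ p.1} :=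
      fun p hp => hc.1.total hp.1 hp.2
    have := closure_minimal hsub NonemptyCompacts.isClosed_comparable
    rw [closure_prod_eq] at this
    exact fun K hK L hL _ => this (Set.mk_mem_prod hK hL)
  have hcl : IsClosed c := by
    have := hc.2 hchain subset_closure
    rw [this]
    exact isClosed_closure
  exact ⟨⟨⟨c, hcl.isCompact⟩, ⟨_, hc.top_mem⟩⟩, hc⟩

/-! ### The maps given by tables -/

theorem MaximalChain.isOpen_inducedLE [CompactSpace X] [T2Space X] {D E : Set X}
    (hD : IsClopen D) (hE : IsClopen E) (hDne : D.Nonempty) (hEne : E.Nonempty)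
    (hDE : Disjoint D E) : IsOpen {c : MaximalChain X | c.InducedLE D E} := by
  have hset : {c : MaximalChain X | c.InducedLE D E} = Subtype.val ⁻¹'
      {c : NonemptyCompacts (NonemptyCompacts X) | ((c : Set (NonemptyCompacts X)) ∩
        ({M | ((M : Set X) ∩ D).Nonempty} ∩ {M | (M : Set X) ⊆ Eᶜ})).Nonempty} := by
    ext c
    refine ⟨fun h => ?_, fun ⟨M, hM, hMD, hME⟩ => ?_⟩
    · obtain ⟨M, hM, h1, h2⟩ := c.exists_mem_of_inducedLE hD hE hDne hEne hDE h
      exact ⟨M, hM, h1, h2⟩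
    · rcases c.inducedLE_total D E with h | h
      · exact h
      · obtain ⟨x, hx, hxE⟩ := c.firstHit_inter_nonempty hE.1 hEne
        exact absurd hxE (hME (c.firstHit_subset_of_mem hM hMD (h hx)))
  rw [hset]
  exact ((NonemptyCompacts.isOpen_inter_nonempty_of_isOpen
    ((NonemptyCompacts.isOpen_inter_nonempty_of_isOpen hD.2).inter
      (NonemptyCompacts.isOpen_subsets_of_isOpen hE.compl.2)))).preimage continuous_subtype_val

theorem MaximalChain.ratio_eq_of_isOrderedBy [CompactSpace X] [T2Space X] {k : ℕ}
    {c : MaximalChain X} {β : OrderedPartition X k} {σ : Equiv.Perm (Fin k)}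
    (h : (β.permute σ).IsOrderedBy c) : c.ratio β = σ :=
  (β.existsUnique_permute_isOrderedBy c).unique (c.isOrderedBy_ratio β) h

theorem OrderedPartition.isOrderedBy_of_le_imp [CompactSpace X] [T2Space X] {k : ℕ}
    {β : OrderedPartition X k} {c : MaximalChain X}
    (h : ∀ i j, i < j → c.InducedLE (β.part i) (β.part j)) : β.IsOrderedBy c := by
  intro i j
  rcases lt_trichotomy i j with hij | rfl | hij
  · exact iff_of_true hij.le (h i j hij)
  · exact iff_of_true le_rfl Set.Subset.rfl
  · refine iff_of_false hij.not_ge fun h' => ?_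
    exact c.firstHit_ne (β.isClopen i) (β.isClopen j) (β.nonempty i) (β.nonempty j)
      (β.disjoint i j hij.ne') (Set.Subset.antisymm h' (h j i hij))

theorem MaximalChain.isOpen_ratio_eq [CompactSpace X] [T2Space X] {k : ℕ}
    (β : OrderedPartition X k) (σ : Equiv.Perm (Fin k)) :
    IsOpen {c : MaximalChain X | c.ratio β = σ} := by
  have hset : {c : MaximalChain X | c.ratio β = σ} =
      ⋂ (i : Fin k) (j : Fin k) (_ : i < j),
        {c : MaximalChain X | c.InducedLE ((β.permute σ).part i) ((β.permute σ).part j)} := by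
    ext c
    simp only [Set.mem_iInter]
    refine ⟨fun h i j hij => ?_, fun h => ratio_eq_of_isOrderedBy
      (OrderedPartition.isOrderedBy_of_le_imp h)⟩
    have h' : c.ratio β = σ := h
    subst h'
    exact (c.isOrderedBy_ratio β i j).1 hij.le
  rw [hset]
  refine isOpen_iInter_of_finite fun i => isOpen_iInter_of_finite fun j =>
    isOpen_iInter_of_finite fun hij => ?_
  exact isOpen_inducedLE ((β.permute σ).isClopen i) ((β.permute σ).isClopen j)
    ((β.permute σ).nonempty i) ((β.permute σ).nonempty j) ((β.permute σ).disjoint i j hij.ne)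

theorem continuous_tableMap [CompactSpace X] [T2Space X] {k : ℕ}
    (T : Equiv.Perm (Fin k) → ℤˣ) :
    Continuous (tableMap T : MaximalChain X → SymbolicSpace X k) := by
  refine continuous_pi (A := fun _ : OrderedPartition X k => ℤˣ) fun β => ?_
  refine IsLocallyConstant.continuous (f := fun c : MaximalChain X => T (c.ratio β)) ?_
  refine IsLocallyConstant.comp (f := fun c : MaximalChain X => c.ratio β) ?_ T
  exact (IsLocallyConstant.iff_isOpen_fiber).2 fun σ => MaximalChain.isOpen_ratio_eq β σ

theorem MaximalChain.firstHit_smul (g : X ≃ₜ X) (c : MaximalChain X) (D : Set X) :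
    (g • c).firstHit (g '' D) = g '' c.firstHit D := by
  have hinter : ∀ A : NonemptyCompacts X, ((expIso g A : NonemptyCompacts X) : Set X) ∩ g '' D =
      g '' ((A : Set X) ∩ D) := fun A => (Set.image_inter g.injective).symm
  ext x
  obtain ⟨y, rfl⟩ := g.surjective x
  rw [g.injective.mem_set_image]
  simp only [firstHit, Set.mem_iInter, members_smul]
  constructor
  · rintro h A ⟨hA, hAD⟩
    have := h (expIso g A) ⟨⟨A, hA, rfl⟩, by rw [hinter]; exact hAD.image g⟩
    exact (g.injective.mem_set_image).1 this
  · rintro h _ ⟨⟨A, hA, rfl⟩, hAD⟩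
    rw [hinter, Set.image_nonempty] at hAD
    exact ⟨y, h A ⟨hA, hAD⟩, rfl⟩

theorem MaximalChain.inducedLE_smul_iff (g : X ≃ₜ X) (c : MaximalChain X) (D E : Set X) :
    (g • c).InducedLE (g '' D) (g '' E) ↔ c.InducedLE D E := by
  rw [InducedLE, firstHit_smul, firstHit_smul, Set.image_subset_image_iff g.injective]
  rfl

theorem MaximalChain.ratio_smul_smul [CompactSpace X] [T2Space X] {k : ℕ} (g : X ≃ₜ X)
    (c : MaximalChain X) (β : OrderedPartition X k) : (g • c).ratio (g • β) = c.ratio β := by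
  refine ratio_eq_of_isOrderedBy fun i j => ?_
  rw [c.isOrderedBy_ratio β i j]
  exact (inducedLE_smul_iff g c _ _).symm

theorem tableMap_smul [CompactSpace X] [T2Space X] {k : ℕ} (T : Equiv.Perm (Fin k) → ℤˣ)
    (g : X ≃ₜ X) (c : MaximalChain X) :
    (tableMap T (g • c) : SymbolicSpace X k) = g • tableMap T c := by
  funext β
  change T ((g • c).ratio β) = T (c.ratio (g⁻¹ • β))
  rw [← MaximalChain.ratio_smul_smul g c (g⁻¹ • β), smul_inv_smul]

end MaximalChains

/-! ### Partitions as continuous maps -/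

section Partitions

variable {X : Type*} [TopologicalSpace X]

theorem IsHHomogeneous.nonempty_homeomorph_fiber (hX : IsHHomogeneous X) {p q : X → ℕ}
    (hp : Continuous p) (hq : Continuous q) (hpq : range p = range q) (n : ℕ) :
    Nonempty (p ⁻¹' {n} ≃ₜ q ⁻¹' {n}) := by
  by_cases hn : n ∈ range p
  · have h1 := hX.homeomorphic _ ((isClopen_discrete {n}).preimage hp)
      (by obtain ⟨x, rfl⟩ := hn; exact ⟨x, rfl⟩)
    have h2 := hX.homeomorphic _ ((isClopen_discrete {n}).preimage hq)
      (by rw [hpq] at hn; obtain ⟨x, rfl⟩ := hn; exact ⟨x, rfl⟩)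
    exact ⟨h1.some.trans h2.some.symm⟩
  · have : IsEmpty (p ⁻¹' {n}) := ⟨fun x => hn ⟨x, x.2⟩⟩
    have : IsEmpty (q ⁻¹' {n}) := ⟨fun x => hn (hpq ▸ ⟨x, x.2⟩)⟩
    exact ⟨Homeomorph.empty⟩

/-- Two clopen partitions of an h-homogeneous compact space with the same indices are conjugate. -/
theorem IsHHomogeneous.exists_homeomorph_comp_eq [CompactSpace X] [T2Space X]
    (hX : IsHHomogeneous X) {p q : X → ℕ} (hp : Continuous p) (hq : Continuous q)
    (hpq : range p = range q) : ∃ g : X ≃ₜ X, ∀ x, q (g x) = p x := by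
  let h := fun n => (hX.nonempty_homeomorph_fiber hp hq hpq n).some
  let e : X ≃ X := Equiv.ofFiberEquiv (f := p) (g := q) fun n => (h n).toEquiv
  have he : ∀ n y (hy : p y = n), e y = h n ⟨y, hy⟩ := by
    rintro _ y rfl
    rfl
  have hcont : Continuous e := by
    rw [continuous_iff_continuousAt]
    intro x
    have hopen : IsOpen (p ⁻¹' {p x}) := (isOpen_discrete {p x}).preimage hp
    refine (hopen.isOpenEmbedding_subtypeVal.continuousAt_iff (x := ⟨x, rfl⟩)).1
      (Continuous.continuousAt ?_)
    have hfun : e ∘ Subtype.val = fun y : p ⁻¹' {p x} => (h (p x) y : X) := by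
      funext ⟨y, hy⟩
      exact he _ y hy
    rw [hfun]
    exact continuous_subtype_val.comp (h (p x)).continuous
  exact ⟨hcont.homeoOfEquivCompactToT2, fun x => (h (p x) ⟨x, rfl⟩).2⟩

/-- A space with a nontrivial clopen set has clopen partitions into any number of pieces. -/
theorem IsHHomogeneous.exists_continuous_range_eq_Iio [Nonempty X] (hX : IsHHomogeneous X)
    {U : Set X} (hU : IsClopen U) (hUne : U.Nonempty) (hUc : Uᶜ.Nonempty) (N : ℕ) :
    ∃ q : X → ℕ, Continuous q ∧ range q = Iio (N + 1) := by
  classical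
  induction N with
  | zero =>
    refine ⟨fun _ => 0, continuous_const, ?_⟩
    ext i
    simp
  | succ N ih =>
    obtain ⟨q, hq, hqr⟩ := ih
    obtain ⟨h⟩ := hX.homeomorphic U hU hUne
    -- Piece 0 is the complement of `U`, and the `N + 1` pieces of `X` are copied into `U` along
    -- `h`.
    refine ⟨fun x => if hx : x ∈ U then q (h ⟨x, hx⟩) + 1 else 0, ?_, ?_⟩
    · rw [continuous_iff_continuousAt]
      intro x
      by_cases hx : x ∈ U
      · refine (hU.2.isOpenEmbedding_subtypeVal.continuousAt_iff (x := ⟨x, hx⟩)).1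
          (Continuous.continuousAt ?_)
        have hfun : (fun x => if hx : x ∈ U then q (h ⟨x, hx⟩) + 1 else 0) ∘ Subtype.val =
            fun y : U => q (h y) + 1 := by
          funext y
          simp
        rw [hfun]
        exact (hq.comp h.continuous).add continuous_const
      · refine (continuousAt_const (y := 0)).congr ?_
        filter_upwards [hU.compl.2.mem_nhds hx] with y hy
        have hy' : y ∉ U := hy
        simp [hy']
    · ext i
      rw [mem_Iio]
      constructor
      · rintro ⟨x, rfl⟩
        by_cases hx : x ∈ U
        · have : q (h ⟨x, hx⟩) ∈ range q := ⟨_, rfl⟩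
          rw [hqr, mem_Iio] at this
          simp only [hx, dif_pos]
          omega
        · simp [hx]
      · intro hi
        rcases Nat.eq_zero_or_pos i with rfl | hi0
        · obtain ⟨x, hx⟩ := hUc
          have hx' : x ∉ U := hx
          exact ⟨x, by simp [hx']⟩
        · have : i - 1 ∈ range q := by rw [hqr, mem_Iio]; omega
          obtain ⟨y, hy⟩ := this
          refine ⟨h.symm y, ?_⟩
          simp only [Subtype.coe_prop, dif_pos, Subtype.coe_eta, Homeomorph.apply_symm_apply, hy]
          omega

/-! ### Index maps, refinements and rigid coarsenings -/

namespace OrderedPartition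

variable {k : ℕ}

theorem existsUnique_mem (β : OrderedPartition X k) (x : X) : ∃! i, x ∈ β.part i := by
  have hx : x ∈ ⋃ i, β.part i := by rw [β.iUnion_eq]; trivial
  obtain ⟨i, hi⟩ := mem_iUnion.1 hx
  refine ⟨i, hi, fun j hj => ?_⟩
  by_contra hji
  exact disjoint_left.1 (β.disjoint j i hji) hj hi

/-- The index of the piece of `β` that contains `x`. -/
noncomputable def index (β : OrderedPartition X k) (x : X) : Fin k := (β.existsUnique_mem x).choose

theorem mem_part_iff (β : OrderedPartition X k) {x : X} {i : Fin k} :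
    x ∈ β.part i ↔ β.index x = i :=
  ⟨fun h => ((β.existsUnique_mem x).unique h (β.existsUnique_mem x).choose_spec.1).symm,
    fun h => h ▸ (β.existsUnique_mem x).choose_spec.1⟩

theorem continuous_index (β : OrderedPartition X k) : Continuous β.index := by
  refine continuous_discrete_rng.2 fun i => ?_
  have : β.index ⁻¹' {i} = β.part i := by
    ext x
    exact β.mem_part_iff.symm
  rw [this]
  exact (β.isClopen i).2

theorem index_surjective (β : OrderedPartition X k) : Function.Surjective β.index := fun i => by
  obtain ⟨x, hx⟩ := β.nonempty i
  exact ⟨x, β.mem_part_iff.1 hx⟩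

theorem ext_index {β γ : OrderedPartition X k} (h : ∀ x, β.index x = γ.index x) : β = γ := by
  ext i x
  rw [mem_part_iff, mem_part_iff, h]

theorem index_smul (g : X ≃ₜ X) (β : OrderedPartition X k) (x : X) :
    (g • β).index (g x) = β.index x := by
  rw [← mem_part_iff]
  exact ⟨x, β.mem_part_iff.2 rfl, rfl⟩

theorem index_permute (σ : Equiv.Perm (Fin k)) (β : OrderedPartition X k) (x : X) :
    σ ((β.permute σ).index x) = β.index x := by
  rw [eq_comm, ← mem_part_iff]
  exact (β.permute σ).mem_part_iff.2 rfl

/-- The partition into the fibres of a continuous surjection. -/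
def ofIndex (p : X → Fin k) (hp : Continuous p) (hs : Function.Surjective p) :
    OrderedPartition X k where
  part i := p ⁻¹' {i}
  isClopen i := (isClopen_discrete {i}).preimage hp
  nonempty i := (singleton_nonempty i).preimage hs
  disjoint i j h := (disjoint_singleton.2 h).preimage p
  iUnion_eq := by
    ext x
    simp

theorem index_ofIndex {p : X → Fin k} {hp : Continuous p} {hs : Function.Surjective p} (x : X) :
    (ofIndex p hp hs).index x = p x := by
  rw [← mem_part_iff]
  rfl

/-- Finitely many partitions have a common refinement. -/
theorem exists_refinement [CompactSpace X] (F : Finset (OrderedPartition X k)) :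
    ∃ (m : ℕ) (γ : OrderedPartition X m), ∀ β ∈ F, ∀ x y, γ.index x = γ.index y →
      β.index x = β.index y := by
  let p : X → (F → Fin k) := fun x β => β.1.index x
  have hp : Continuous p := continuous_pi fun β => β.1.continuous_index
  let e := Finite.equivFin (range p)
  have hs : Function.Surjective fun x => e ⟨p x, x, rfl⟩ := by
    intro i
    obtain ⟨⟨_, x, rfl⟩, hx⟩ := e.surjective i
    exact ⟨x, hx⟩
  have hc : Continuous fun x => e ⟨p x, x, rfl⟩ :=
    (continuous_of_discreteTopology (f := e)).comp (hp.subtype_mk _)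
  refine ⟨_, ofIndex _ hc hs, fun β hβ x y hxy => ?_⟩
  rw [index_ofIndex, index_ofIndex] at hxy
  have := congrArg Subtype.val (e.injective hxy)
  exact congrFun this ⟨β, hβ⟩

/-- If `γ` is listed in the order induced by `c` and refines `β`, then the map from the pieces of
`γ` to the pieces of `β`, listed in the order induced by `c`, is a rigid surjection. -/
theorem exists_rigidSurj_of_isOrderedBy [CompactSpace X] [T2Space X] {m : ℕ}
    {c : MaximalChain X} {γ : OrderedPartition X m} {β : OrderedPartition X k}
    (hγ : γ.IsOrderedBy c) (hβ : β.IsOrderedBy c)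
    (href : ∀ x y, γ.index x = γ.index y → β.index x = β.index y) :
    ∃ f : ℕ → ℕ, RigidSurj 0 m k f ∧ ∀ x, f (γ.index x) = β.index x := by
  choose x hx using γ.index_surjective
  have hsub : ∀ i, γ.part i ⊆ β.part (β.index (x i)) := fun i y hy =>
    β.mem_part_iff.2 (href _ _ (by rw [hx, γ.mem_part_iff.1 hy]))
  refine ⟨fun i => if h : i < m then β.index (x ⟨i, h⟩) else 0, ⟨?_, ?_, ?_, ?_⟩, ?_⟩
  · intro i hi
    simp [hi]
  · intro i hi
    omega
  · intro i hi
    simp only [show ¬ i < m by omega, dif_neg, not_false_iff]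
  · intro v hv
    -- The piece of `γ` containing a point `y` of the first hit of piece `v` is the first one inside
    -- that piece. If an earlier piece of `γ` had value at least `v`, its first hit would contain
    -- `y`, although it is disjoint from the piece of `γ` through `y`.
    obtain ⟨y, hyF, hyβ⟩ := c.firstHit_inter_nonempty (β.isClopen ⟨v, hv⟩).1 (β.nonempty _)
    refine ⟨γ.index y, Fin.is_lt _, ?_, ?_⟩
    · simp only [Fin.is_lt, dif_pos, Fin.eta]
      rw [href _ y (hx _), β.mem_part_iff.1 hyβ]
    · intro j hj
      have hjm : j < m := hj.trans (Fin.is_lt _)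
      simp only [hjm, dif_pos]
      by_contra hvj
      have hne : (⟨j, hjm⟩ : Fin m) < γ.index y := hj
      have h1 : c.InducedLE (γ.part ⟨j, hjm⟩) (γ.part (γ.index y)) := (hγ _ _).1 hne.le
      have h2 := c.disjoint_firstHit (γ.isClopen _) (γ.isClopen _) (γ.nonempty _) (γ.nonempty _)
        (γ.disjoint _ _ hne.ne) h1
      have h3 : c.InducedLE (β.part ⟨v, hv⟩) (β.part (β.index (x ⟨j, hjm⟩))) :=
        (hβ _ _).1 (not_lt.1 hvj)
      exact disjoint_left.1 h2 (c.firstHit_anti (hsub _) (h3 hyF)) (γ.mem_part_iff.2 rfl)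
  · intro y
    simp only [Fin.is_lt, dif_pos, Fin.eta]
    rw [href _ y (hx _)]

end OrderedPartition

/-! ### Tables from the Graham-Rothschild theorem -/

/-- The values of `ω` on the coarsenings of the partition `q` into `m` pieces are given by the table
`T`. -/
def TableOn {k : ℕ} (ω : SymbolicSpace X k) (T : Equiv.Perm (Fin k) → ℤˣ) (m : ℕ)
    (q : X → ℕ) : Prop :=
  ∀ f, RigidSurj 1 m k f → ∀ (σ : Equiv.Perm (Fin k)) (β : OrderedPartition X k),
    (∀ x, (σ.symm (β.index x) : ℕ) = f (q x)) → ω β = T σ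

theorem RigidSurj.range_comp {Y : Type*} {a N M : ℕ} {R : ℕ → ℕ} (hR : RigidSurj a N M R)
    {q : Y → ℕ}
    (hq : range q = Iio N) : range (R ∘ q) = Iio M := by
  rw [Set.range_comp, hq]
  ext v
  constructor
  · rintro ⟨i, hi, rfl⟩
    exact hR.lt i hi
  · intro hv
    obtain ⟨i, hi, hiv, -⟩ := hR.occurs v hv
    exact ⟨i, hi, hiv⟩

/-- Graham-Rothschild with `a = 1` is applied with whole tables as colours. A partition is
determined by its index map, so the chosen `β` is the only one; the value 1 is a filler when there
is none. -/
theorem exists_tableOn {k : ℕ} (hk : 1 ≤ k)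
    (hpart : ∀ N, ∃ q : X → ℕ, Continuous q ∧ range q = Iio (N + 1)) (ω : SymbolicSpace X k)
    (m : ℕ) (hm : 1 ≤ m) :
    ∃ T q, Continuous q ∧ range q = Iio m ∧ TableOn ω T m q := by
  classical
  obtain ⟨N, hN⟩ := grahamRothschild le_rfl hk m (Equiv.Perm (Fin k) → ℤˣ) hm
  obtain ⟨q, hq, hqr⟩ := hpart (N - 1)
  obtain ⟨R, hR, T, hT⟩ := hN fun s σ =>
    if h : ∃ β : OrderedPartition X k, ∀ x, (σ.symm (β.index x) : ℕ) = s (q x) then ω h.choose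
    else 1
  have hN1 := hR.le_dom hm
  rw [Nat.sub_add_cancel hN1] at hqr
  refine ⟨T, R ∘ q, continuous_of_discreteTopology.comp hq, hR.range_comp hqr,
    fun f hf σ β hβ => ?_⟩
  have h : ∃ β : OrderedPartition X k, ∀ x, (σ.symm (β.index x) : ℕ) = (f ∘ R) (q x) := ⟨β, hβ⟩
  rw [← hT f hf]
  simp only [dif_pos h]
  congr 1
  refine OrderedPartition.ext_index fun x => σ.symm.injective (Fin.ext ?_)
  rw [hβ x, h.choose_spec x]
  rfl

/-- Merging the pieces numbered `m` and above into piece 0 is a rigid surjection, so coarsenings of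
the result are rigid coarsenings of `q`. -/
theorem TableOn.exists_of_le {k : ℕ} {ω : SymbolicSpace X k} {T : Equiv.Perm (Fin k) → ℤˣ}
    {m M : ℕ} {q : X → ℕ} (h : TableOn ω T M q) (hq : Continuous q) (hqr : range q = Iio M)
    (hm : 1 ≤ m) (hmM : m ≤ M) :
    ∃ q, Continuous q ∧ range q = Iio m ∧ TableOn ω T m q := by
  have hR : RigidSurj 1 M m fun i => if i < m then i else 0 := by
    refine ⟨fun i hi => ?_, fun i hi => ?_, fun i hi => ?_, fun v hv => ?_⟩
    · split_ifs <;> omega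
    · split_ifs <;> omega
    · split_ifs <;> omega
    · refine ⟨v, by omega, by simp [hv], fun j hj => ?_⟩
      split_ifs <;> omega
  exact ⟨_, continuous_of_discreteTopology.comp hq, hR.range_comp hqr,
    fun f hf σ β hβ => h _ (hf.comp le_rfl hR) σ β hβ⟩

/-- If each of the finitely many tables failed at some size, the table found at the largest of these
sizes would, by `TableOn.exists_of_le`, succeed at its own bad size. -/
theorem exists_forall_tableOn {k : ℕ} (hk : 1 ≤ k)
    (hpart : ∀ N, ∃ q : X → ℕ, Continuous q ∧ range q = Iio (N + 1)) (ω : SymbolicSpace X k) :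
    ∃ T, ∀ m, 1 ≤ m → ∃ q, Continuous q ∧ range q = Iio m ∧ TableOn ω T m q := by
  by_contra! h
  choose m hm hbad using h
  obtain ⟨M, hM⟩ := Finite.exists_le m
  have hM1 : 1 ≤ M := (hm fun _ => 1).trans (hM _)
  obtain ⟨T, q, hq, hqr, hT⟩ := exists_tableOn hk hpart ω M hM1
  obtain ⟨q', hq', hqr', hT'⟩ := hT.exists_of_le hq hqr (hm T) (hM T)
  exact hbad T q' hq' hqr' hT'

/-- If `T` describes `ω` on partitions of all sizes, then every value of `tableMap T` is a limit of
translates of `ω`. -/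
theorem exists_smul_eq_tableMap [CompactSpace X] [T2Space X] [Nonempty X]
    (hX : IsHHomogeneous X) {k : ℕ} {ω : SymbolicSpace X k} {T : Equiv.Perm (Fin k) → ℤˣ}
    (hT : ∀ m, 1 ≤ m → ∃ q, Continuous q ∧ range q = Iio m ∧ TableOn ω T m q)
    (c : MaximalChain X) (F : Finset (OrderedPartition X k)) :
    ∃ g : X ≃ₜ X, ∀ β ∈ F, (g • ω) β = tableMap T c β := by
  obtain ⟨m, γ₀, hγ₀⟩ := OrderedPartition.exists_refinement F
  let γ := γ₀.permute (c.ratio γ₀)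
  have hγc : γ.IsOrderedBy c := c.isOrderedBy_ratio γ₀
  have hγ : ∀ β ∈ F, ∀ x y, γ.index x = γ.index y → β.index x = β.index y := by
    intro β hβ x y hxy
    refine hγ₀ β hβ x y ?_
    rw [← γ₀.index_permute (c.ratio γ₀) x, ← γ₀.index_permute (c.ratio γ₀) y]
    exact congrArg _ hxy
  have hm : 1 ≤ m := (Fin.pos (γ.index (Classical.arbitrary X)))
  obtain ⟨q, hq, hqr, hqT⟩ := hT m hm
  have hr : range q = range fun x => (γ.index x : ℕ) := by
    rw [hqr]
    ext i
    constructor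
    · intro hi
      obtain ⟨x, hx⟩ := γ.index_surjective ⟨i, hi⟩
      exact ⟨x, by simp [hx]⟩
    · rintro ⟨x, rfl⟩
      exact Fin.is_lt _
  -- This is where h-homogeneity enters: `g` carries the partition governed by `T` to the ordered
  -- refinement `γ`.
  obtain ⟨g, hg⟩ := hX.exists_homeomorph_comp_eq hq
    ((continuous_of_discreteTopology (f := fun i : Fin m => (i : ℕ))).comp γ.continuous_index) hr
  refine ⟨g, fun β hβ => ?_⟩
  have href : ∀ x y, γ.index x = γ.index y →
      (β.permute (c.ratio β)).index x = (β.permute (c.ratio β)).index y := by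
    intro x y hxy
    apply (c.ratio β).injective
    rw [β.index_permute, β.index_permute, hγ β hβ x y hxy]
  obtain ⟨f, hf, hfβ⟩ := OrderedPartition.exists_rigidSurj_of_isOrderedBy hγc
    (c.isOrderedBy_ratio β) href
  -- Rigidity already forces `f 0 = 0`, since nothing lies below 0 to precede its first occurrence.
  have hf1 : RigidSurj 1 m k f := by
    refine ⟨hf.lt, fun i hi => ?_, hf.eq_zero, hf.occurs⟩
    obtain rfl : i = 0 := by omega
    obtain ⟨i, -, hi0, hlt⟩ := hf.occurs 0 (by have := hf.lt 0 hm; omega)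
    rcases Nat.eq_zero_or_pos i with rfl | hi
    · exact hi0
    · exact absurd (hlt 0 hi) (by omega)
  change ω (g⁻¹ • β) = T (c.ratio β)
  refine hqT f hf1 _ _ fun x => ?_
  have h1 : (g⁻¹ • β).index x = β.index (g x) := by
    have := OrderedPartition.index_smul g (g⁻¹ • β) x
    rw [smul_inv_smul] at this
    exact this.symm
  rw [h1, ← β.index_permute (c.ratio β) (g x), Equiv.symm_apply_apply, ← hfβ]
  congr 1
  exact hg x

/-- A basic open set of the product restricts finitely many coordinates, on which some translate of
`ω` agrees with `tableMap T c`. Closedness of `S` then suffices. -/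
theorem tableMap_mem_of_tableOn [CompactSpace X] [T2Space X] [Nonempty X]
    (hX : IsHHomogeneous X) {k : ℕ} {S : Set (SymbolicSpace X k)} (hS : IsClosed S)
    (hinv : ∀ (g : X ≃ₜ X), ∀ z ∈ S, g • z ∈ S) {ω : SymbolicSpace X k} (hω : ω ∈ S)
    {T : Equiv.Perm (Fin k) → ℤˣ}
    (hT : ∀ m, 1 ≤ m → ∃ q, Continuous q ∧ range q = Iio m ∧ TableOn ω T m q)
    (c : MaximalChain X) : tableMap T c ∈ S := by
  rw [← hS.closure_eq, mem_closure_iff]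
  intro o ho hco
  obtain ⟨F, u, hu, hsub⟩ := (isOpen_pi_iff (A := fun _ : OrderedPartition X k => ℤˣ)).1 ho _ hco
  obtain ⟨g, hg⟩ := exists_smul_eq_tableMap hX hT c F
  refine ⟨g • ω, hsub fun β hβ => ?_, hinv g ω hω⟩
  rw [hg β hβ]
  exact (hu β hβ).2

/-! ### Minimality and the conclusion -/

theorem isFactorMapOnto_of_mapsTo [CompactSpace X] [T2Space X] [Nonempty X]
    (hX : IsHHomogeneous X) {k : ℕ} {S : Set (SymbolicSpace X k)}
    (hS : IsMinimalSubsystem (X ≃ₜ X) S) {T : Equiv.Perm (Fin k) → ℤˣ}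
    (hT : ∀ c : MaximalChain X, tableMap T c ∈ S) :
    IsFactorMapOnto (X ≃ₜ X) (tableMap T : MaximalChain X → SymbolicSpace X k) S := by
  have hcomp : CompactSpace (MaximalChain X) := MaximalChain.compactSpace hX.zeroDimensional
  have hne : Nonempty (MaximalChain X) := MaximalChain.nonempty
  have : T2Space (SymbolicSpace X k) := inferInstanceAs (T2Space (OrderedPartition X k → ℤˣ))
  refine ⟨continuous_tableMap T, tableMap_smul T, ?_⟩
  refine (hS.eq_empty_or_eq _ (range_subset_iff.2 hT)
    (isCompact_range (continuous_tableMap T)).isClosed ?_).resolve_left (range_nonempty _).ne_empty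
  rintro g _ ⟨c, rfl⟩
  exact ⟨g • c, tableMap_smul T g c⟩

theorem OrderedPartition.subsingleton_of_forall_isClopen {k : ℕ}
    (h : ∀ U : Set X, IsClopen U → U.Nonempty → ¬ Uᶜ.Nonempty) :
    Subsingleton (OrderedPartition X k) := by
  have huniv : ∀ (β : OrderedPartition X k) i, β.part i = univ := fun β i =>
    compl_empty_iff.1 (not_nonempty_iff_eq_empty.1 (h _ (β.isClopen i) (β.nonempty i)))
  refine ⟨fun β γ => ?_⟩
  ext1
  funext i
  rw [huniv, huniv]

end Partitions

theorem theorem4p7 {X : Type*} [TopologicalSpace X] [CompactSpace X] [T2Space X] [Nonempty X]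
    (hX : IsHHomogeneous X) (k : ℕ) (S : Set (SymbolicSpace X k))
    (hS : IsMinimalSubsystem (X ≃ₜ X) S) :
    ∃ T : Equiv.Perm (Fin k) → ℤˣ,
      IsFactorMapOnto (X ≃ₜ X) (tableMap T : MaximalChain X → SymbolicSpace X k) S := by
  obtain ⟨ω, hω⟩ := hS.nonempty
  -- Two distinct partitions force `1 ≤ k` and a nontrivial clopen set, hence partitions of every
  -- positive size. With at most one partition `ω` is constant, and a constant table reproduces it.
  by_cases htriv : ∃ β₀ β₁ : OrderedPartition X k, β₀ ≠ β₁
  · obtain ⟨β₀, β₁, hβ⟩ := htriv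
    have hk : 1 ≤ k := Fin.pos (β₀.index (Classical.arbitrary X))
    have hU : ∃ U : Set X, IsClopen U ∧ U.Nonempty ∧ Uᶜ.Nonempty := by
      by_contra! h
      have := OrderedPartition.subsingleton_of_forall_isClopen (k := k)
        fun U hU hne => not_nonempty_iff_eq_empty.2 (h U hU hne)
      exact hβ (Subsingleton.elim _ _)
    obtain ⟨U, hU, hUne, hUc⟩ := hU
    obtain ⟨T, hT⟩ := exists_forall_tableOn hk
      (hX.exists_continuous_range_eq_Iio hU hUne hUc) ω
    exact ⟨T, isFactorMapOnto_of_mapsTo hX hS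
      fun c => tableMap_mem_of_tableOn hX hS.isClosed hS.smul_mem hω hT c⟩
  · push Not at htriv
    have hconst : ∃ t : ℤˣ, ∀ β, ω β = t := by
      rcases isEmpty_or_nonempty (OrderedPartition X k) with h | ⟨⟨β₀⟩⟩
      · exact ⟨1, fun β => h.elim β⟩
      · exact ⟨ω β₀, fun β => by rw [htriv β β₀]⟩
    obtain ⟨t, ht⟩ := hconst
    refine ⟨fun _ => t, isFactorMapOnto_of_mapsTo hX hS fun c => ?_⟩
    have : (tableMap (fun _ => t) c : SymbolicSpace X k) = ω := funext fun β => (ht β).symm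
    rwa [this]
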